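/- Let $n\ge 1$ and $[m]=\{1,\dots,m\}$. \textbf{The Kreweras lattice.} $\mathtt{NCP}(n)$ is the set of non-crossing partitions of $[n]$ (set partitions such that $a<b<c<d$ with $a,c$ in a block $B$ and $b,d$ in a block $C$ implies $B=C$), ordered by refinement. A \emph{noncommutative crossing partition} of $[n]$ is a sequence $\pi=(\pi_1,\dots,\pi_l)$ of non-empty blocks, each written as an increasing sequence, such that every element of $[n]$ occurs exactly once and $\max\pi_i>\min\pi_{i+1}$ for $1\le i<l$. It is $312$-\emph{avoiding} if there are no $i<j\le k$ and $x\in\pi_i$, $y\in\pi_j$, $z\in\pi_k$ with $y<z<x$. The set of all of them is $\mathtt{NCCP}(n)$, and $\mathtt{NCCP}(n;312)$ is the subset of the $312$-avoiding ones. Let $T_\pi$ be the unique binary tree with nodes labeled bijectively by $[n]$, increasing from the root to the leaves, whose in-order word (left subtree, root, right subtree) is the concatenation of $\pi_1,\dots,\pi_l$. \textbf{Rotations.} In a labeled tree $T$, let the node $b$ be the left child of $m_0$, and let $m_0,b,m_1,\dots,m_p$ be the maximal sequence starting at $m_0$ in which each node is the left child of the preceding one. Let $a$ be a node such that $b$ lies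 in the left subtree of $a$ and such that, whenever $b$ lies in the left subtree of a node $c$ and some label smaller than $b$ lies in the right subtree of $c$, $a$ is not a proper ancestor of $c$. Let $S\subseteq\{m_1,\dots,m_p\}$. Let $T_1$ be the tree whose root is $b$, in which the nodes of $\{b\}\cup S$ form, in increasing order, a path of left edges, and in which each of them keeps its right subtree from $T$. Let $T_2$ be the tree obtained from $T$ by deleting the nodes of $\{b\}\cup S$ together with their right subtrees and joining the remaining nodes of the sequence, in increasing order, by left edges. The \emph{rotation} $T'$ of $T$ by $(b,a,S)$ is obtained from $T_2$ by merging the maximal path of right edges starting at $b$ in $T_1$ into the maximal path of right edges starting at $a$ in $T_2$, in increasing order of the labels, every node of these paths keeping its left subtree. If $T_{\pi'}$ is a rotation of $T_\pi$ by $(b,a,S)$, we call $\pi'$ a rotation of $\pi$ and $(a,b)$ a \emph{refined label} of the edge $\pi\lessdot\pi'$. The order $\le$ on $\mathtt{NCCP}(n)$ is the reflexive and transitive closure of $\lessdot$, and $\mathtt{NCCP}(n;312)$ has the induced order. The Kreweras lattice $\mathcal L_{\mathrm{Kre}}(n)$ is $(\mathtt{NCP}(n),\subseteq)$, or equivalently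 $(\mathtt{NCCP}(n;312),\le)$. A \emph{parking function} of length $m$ is a sequence $(a_1,\dots,a_m)$ in $[m]$ whose increasing rearrangement $\tilde a_1\le\dots\le\tilde a_m$ satisfies $\tilde a_i\le i$ for all $i$. \textbf{Theorem.} The number of maximal chains of $\mathcal L_{\mathrm{Kre}}(n)$ is $n^{n-2}$, both for $(\mathtt{NCP}(n),\subseteq)$ and for $(\mathtt{NCCP}(n;312),\le)$. Moreover, for every maximal chain $C$ of $(\mathtt{NCCP}(n;312),\le)$ there is exactly one pair of sequences $(a_1,\dots,a_{n-1})$, $(b_1,\dots,b_{n-1})$ such that the elements of $C$ can be listed as $x_0\lessdot x_1\lessdot\dots\lessdot x_{n-1}$ with $(a_i,b_i)$ a refined label of $x_{i-1}\lessdot x_i$ for all $i$, and $C\mapsto(a_1,\dots,a_{n-1})$ is a bijection from the set of maximal chains onto the set of parking functions of length $n-1$. -/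

import Mathlib

/-! ### Non-crossing partitions -/

/-- A set partition of `[n]` is non-crossing if `a < b < c < d` with `a, c` in a block `B` and
`b, d` in a block `C` forces `B = C`. -/
def IsNonCrossing {n : ℕ} (P : Finpartition (Finset.Icc 1 n)) : Prop :=
  ∀ B ∈ P.parts, ∀ C ∈ P.parts, ∀ a b c d : ℕ,
    a < b → b < c → c < d → a ∈ B → c ∈ B → b ∈ C → d ∈ C → B = C

/-- The Kreweras lattice: non-crossing partitions of `[n]`, ordered by refinement (the order of
`Finpartition`: `P ≤ Q` iff each block of `P` lies in a block of `Q`). -/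
abbrev NCP (n : ℕ) : Type :=
  {P : Finpartition (Finset.Icc 1 n) // IsNonCrossing P}

/-! ### Noncommutative crossing partitions -/

/-- A noncommutative crossing partition of `[n]`: a sequence of blocks, each written as an
increasing list, that uses each element of `[n]` exactly once and satisfies
`max πᵢ > min πᵢ₊₁` for consecutive blocks. -/
@[ext]
structure NCCP (n : ℕ) where
  blocks : List (List ℕ)
  ne_nil : ∀ B ∈ blocks, B ≠ []
  perm : blocks.flatten.Perm (List.range' 1 n)
  increasing : ∀ B ∈ blocks, B.Pairwise (· < ·)
  /-- `max B > min C` for consecutive blocks `B`, `C`. -/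
  descent : blocks.IsChain (fun B C => ∃ x ∈ B, ∃ y ∈ C, y < x)

namespace NCCP

/-- The permutation (in one-line notation) obtained by concatenating the blocks. -/
def word {n : ℕ} (π : NCCP n) : List ℕ := π.blocks.flatten

/-- `312`-avoidance: there are no blocks `πᵢ, πⱼ, πₖ` with `i < j ≤ k` and
`x ∈ πᵢ`, `y ∈ πⱼ`, `z ∈ πₖ` with `y < z < x`. -/
def Avoids312 {n : ℕ} (π : NCCP n) : Prop :=
  ∀ i j k : Fin π.blocks.length, i < j → j ≤ k →
    ∀ x ∈ π.blocks.get i, ∀ y ∈ π.blocks.get j, ∀ z ∈ π.blocks.get k, ¬ (y < z ∧ z < x)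

end NCCP

/-! ### Labeled binary trees

A labeled binary tree is a `BinaryTree ℕ`; the nodes of a tree with distinct labels are referred
to by their labels. -/

namespace LabeledTree

open BinaryTree

/-- The word of a tree in the in-order: left subtree, root, right subtree. -/
def inorder : BinaryTree ℕ → List ℕ
  | nil => []
  | node a l r => inorder l ++ a :: inorder r

/-- The labels increase from the root to the leaves. -/
def IsIncreasing : BinaryTree ℕ → Prop
  | nil => True
  | node a l r =>
      (∀ x ∈ inorder l, a < x) ∧ (∀ x ∈ inorder r, a < x) ∧ IsIncreasing l ∧ IsIncreasing r

/-- A labeled tree with `n` nodes: each label in `[n]` appears exactly once, and the labels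
increase from the root to the leaves. -/
def IsLabeled (n : ℕ) (T : BinaryTree ℕ) : Prop :=
  (inorder T).Perm (List.range' 1 n) ∧ IsIncreasing T

/-- `IsSubtree s T`: `s` is `T`, or the full subtree of `T` below one of its children. -/
def IsSubtree (s : BinaryTree ℕ) : BinaryTree ℕ → Prop
  | nil => s = nil
  | node a l r => s = node a l r ∨ IsSubtree s l ∨ IsSubtree s r

/-- `x` is in the left subtree of the node `c`. -/
def InLeft (T : BinaryTree ℕ) (c x : ℕ) : Prop :=
  ∃ l r, IsSubtree (node c l r) T ∧ x ∈ inorder l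

/-- `x` is in the right subtree of the node `c`. -/
def InRight (T : BinaryTree ℕ) (c x : ℕ) : Prop :=
  ∃ l r, IsSubtree (node c l r) T ∧ x ∈ inorder r

/-- Replace the subtree `s` rooted at the node `c` by `f s`. -/
def modifyAt (c : ℕ) (f : BinaryTree ℕ → BinaryTree ℕ) : BinaryTree ℕ → BinaryTree ℕ
  | nil => nil
  | node a l r => if a = c then f (node a l r) else node a (modifyAt c f l) (modifyAt c f r)

/-- The left-extended sequence of the root: the nodes reached from the root by left edges only,
from the root on, each with its right subtree. -/
def leftSpine : BinaryTree ℕ → List (ℕ × BinaryTree ℕ)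
  | nil => []
  | node a l r => (a, r) :: leftSpine l

/-- The tree whose left-extended sequence (with right subtrees) is the given list. -/
def ofLeftSpine : List (ℕ × BinaryTree ℕ) → BinaryTree ℕ
  | [] => nil
  | p :: ps => node p.1 (ofLeftSpine ps) p.2

/-- The right-extended sequence of the root: the nodes reached from the root by right edges only,
from the root on, each with its left subtree. -/
def rightSpine : BinaryTree ℕ → List (ℕ × BinaryTree ℕ)
  | nil => []
  | node a l r => (a, l) :: rightSpine r

/-- The tree whose right-extended sequence (with left subtrees) is the given list. -/
def ofRightSpine : List (ℕ × BinaryTree ℕ) → BinaryTree ℕ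
  | [] => nil
  | p :: ps => node p.1 p.2 (ofRightSpine ps)

/-- Merge the right-extended sequences of the roots of `s` and `t` in increasing order of the
labels; every node keeps its left subtree. -/
def mergeRight (s t : BinaryTree ℕ) : BinaryTree ℕ :=
  ofRightSpine ((rightSpine s).merge (rightSpine t) fun p q => decide (p.1 ≤ q.1))

/-- The admissible choices of the node `na` for a node `m`: first, `na` belongs to the left set of
`m`, i.e. `m` lies in the left subtree of `na`. Second, if `m` lies in the left and some label
`m' < m` in the right subtree of a node `c`, then `na` is not a proper ancestor of `c`. (All these
`c` are on the path from `m` to the root, so this is the condition for the lowest of them, which is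
the one that belongs to the left-most `m'`.) -/
def IsAdmissible (T : BinaryTree ℕ) (m na : ℕ) : Prop :=
  InLeft T na m ∧
    ∀ c m', InLeft T c m → InRight T c m' → m' < m → ¬ (InLeft T na c ∨ InRight T na c)

/-- `T'` is the rotation of `T` by the triplet `(m, na, S)`. Here `m` is the left child of a node
`m₀`; the left-extended sequence of `m₀` is `m₀, m, ms` with right subtrees `U₀, U, …`; `S` is a
set of labels of `ms`. The tree `T₁` has the left-extended sequence `m` followed by the nodes of
`ms` in `S`; the tree `T₂` is `T` with these nodes (and their right subtrees) deleted; and `T'`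
arises from `T₂` by merging `T₁` into the right-extended sequence of `na`. -/
def IsRotationBy (T T' : BinaryTree ℕ) (m na : ℕ) (S : Finset ℕ) : Prop :=
  IsAdmissible T m na ∧
    ∃ (m₀ : ℕ) (U₀ U : BinaryTree ℕ) (ms : List (ℕ × BinaryTree ℕ)) (s : BinaryTree ℕ),
      IsSubtree s T ∧ leftSpine s = (m₀, U₀) :: (m, U) :: ms ∧
      (∀ x ∈ S, x ∈ ms.map Prod.fst) ∧
      T' = modifyAt na
        (fun t => mergeRight t (ofLeftSpine ((m, U) :: ms.filter fun p => decide (p.1 ∈ S))))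
        (modifyAt m₀
          (fun _ => ofLeftSpine ((m₀, U₀) :: ms.filter fun p => decide (p.1 ∉ S))) T)

end LabeledTree

/-! ### The order on noncommutative crossing partitions and the refined labeling -/

namespace NCCP

/-- `π'` is a rotation of `π`, and `(a, b)` is the refined label of this edge: the labeled trees
`T`, `T'` with in-order words `π`, `π'` are related by the rotation with a triplet `(b, a, S)`. -/
def RotatesTo {n : ℕ} (π π' : NCCP n) (a b : ℕ) : Prop :=
  ∃ T T' : BinaryTree ℕ, LabeledTree.IsLabeled n T ∧ LabeledTree.IsLabeled n T' ∧
    LabeledTree.inorder T = π.word ∧ LabeledTree.inorder T' = π'.word ∧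
    ∃ S : Finset ℕ, LabeledTree.IsRotationBy T T' b a S

/-- The cover relation: `π'` is a rotation of `π`. -/
def Rotates {n : ℕ} (π π' : NCCP n) : Prop := ∃ a b : ℕ, RotatesTo π π' a b

/-- The order on `NCCP n`: `π ≤ π'` iff `π'` is reached from `π` by a finite sequence of
rotations. -/
instance (n : ℕ) : Preorder (NCCP n) where
  le π π' := Relation.ReflTransGen Rotates π π'
  le_refl _ := Relation.ReflTransGen.refl
  le_trans _ _ _ h₁ h₂ := Relation.ReflTransGen.trans h₁ h₂

end NCCP

/-- The `312`-avoiding noncommutative crossing partitions, with the order induced from `NCCP n`. -/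
abbrev NCCP312 (n : ℕ) : Type := {π : NCCP n // π.Avoids312}

/-- `(a₁, b₁), …, (aₙ₋₁, bₙ₋₁)` are the refined labels along the chain `C`: the chain is
`x₀ ⋖ x₁ ⋖ ⋯ ⋖ xₙ₋₁`, each `xᵢ` is a rotation of `xᵢ₋₁`, and `(aᵢ, bᵢ)` is the refined label
of this step. -/
def HasRefinedLabels {n : ℕ} (C : Flag (NCCP312 n)) (a b : Fin (n - 1) → ℕ) : Prop :=
  ∃ x : ℕ → NCCP312 n, C.carrier = x '' Set.Iio n ∧
    ∀ i : Fin (n - 1), NCCP.RotatesTo (x i).1 (x (i + 1)).1 (a i) (b i)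

/-- Parking functions of length `m`: sequences in `[m]` whose increasing rearrangement
`ã₁ ≤ ⋯ ≤ ãₘ` satisfies `ãᵢ ≤ i` (the position `i` is `j + 1` for `j : Fin m`). -/
def IsParkingFunction {m : ℕ} (a : Fin m → ℕ) : Prop :=
  (∀ j, 1 ≤ a j ∧ a j ≤ m) ∧ ∀ j : Fin m, a (Tuple.sort a j) ≤ j + 1

/-! ### Non-crossing partitions as equivalence relations, and their rank -/

namespace NCP

variable {n : ℕ}

/-! A maximal chain of non-crossing partitions is encoded by its merges. When two blocks merge, let
`b` be the larger of the two minima and `a` the largest element below `b` of the other block; this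
is `NCP.Step P Q a b`. The rank counts the elements that are not block minima and grows by one in
each step, the new non-minimum being `b`. Below every larger partition there is a step
(`exists_step_of_lt`), so a maximal chain consists of `n - 1` steps from singletons to a single
block. Its labels are unique, and they determine it.

The label sequences that occur are exactly those with `IsTreeLabeling`: `b` takes each value in `2,
…, n` once, and the arcs from `a t` to `b t` do not cross and come in a prescribed order at a common
left end. Necessity follows from non-crossing; for sufficiency the merges are carried out in order,
with the invariant `Compatible`. Such a `b` is forced by `a`: the value `p` belongs to the unused
index `t` with `a t < p` for which `(a t, t)` is lexicographically largest. The parking condition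
says that this greedy choice never runs out of candidates. Hence chains correspond to parking
functions (`NCP.exists_flag_equiv`). These are counted on a circle with one extra spot: of the `m +
1` shifts of any function exactly one parks.

The second realization is transferred to the first through trees. A word avoids `312` iff the labels
of its increasing tree are in pre-order (`IsPreorder`). The maximal paths of right edges of such a
tree form a non-crossing partition, which determines the tree. A rotation by `(b, a, S)` merges the
right chain of `b` into that of `a` and leaves the other chains alone, whatever `S` is
(`IsRotationBy.chains`). Between trees in pre-order the rotations are therefore exactly the steps,
with the same labels (`NCCP312.rotatesTo_iff`). Since steps lift to rotations and rotations only
coarsen, this gives the isomorphism `NCCP312.orderIso`, which carries refined labels to step labels.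
-/

/-- `x` and `y` lie in the same block of `P`. -/
def Rel (P : NCP n) (x y : ℕ) : Prop := ∃ B ∈ P.1.parts, x ∈ B ∧ y ∈ B

variable {P Q R : NCP n} {a b a' b' x y z w : ℕ}

theorem Rel.symm (h : P.Rel x y) : P.Rel y x := by
  obtain ⟨B, hB, hx, hy⟩ := h
  exact ⟨B, hB, hy, hx⟩

theorem Rel.trans (h : P.Rel x y) (h' : P.Rel y z) : P.Rel x z := by
  obtain ⟨B, hB, hx, hy⟩ := h
  obtain ⟨C, hC, hy', hz⟩ := h'
  obtain rfl := P.1.eq_of_mem_parts hB hC hy hy'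
  exact ⟨B, hB, hx, hz⟩

theorem Rel.mem_left (h : P.Rel x y) : x ∈ Finset.Icc 1 n := by
  obtain ⟨B, hB, hx, hy⟩ := h
  exact P.1.le hB hx

theorem Rel.mem_right (h : P.Rel x y) : y ∈ Finset.Icc 1 n := h.symm.mem_left

theorem rel_refl (P : NCP n) (hx : x ∈ Finset.Icc 1 n) : P.Rel x x := by
  obtain ⟨B, hB, hx⟩ := P.1.exists_mem hx
  exact ⟨B, hB, hx, hx⟩

theorem rel_cross (P : NCP n) (h1 : w < x) (h2 : x < y) (h3 : y < z) (hwy : P.Rel w y)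
    (hxz : P.Rel x z) : P.Rel w x := by
  obtain ⟨B, hB, hw, hy⟩ := hwy
  obtain ⟨C, hC, hx, hz⟩ := hxz
  obtain rfl := P.2 B hB C hC w x y z h1 h2 h3 hw hy hx hz
  exact ⟨B, hB, hw, hx⟩

theorem le_iff_rel : P ≤ Q ↔ ∀ x y, P.Rel x y → Q.Rel x y := by
  constructor
  · rintro h x y ⟨B, hB, hx, hy⟩
    obtain ⟨C, hC, hBC⟩ := h hB
    exact ⟨C, hC, hBC hx, hBC hy⟩
  · intro h B hB
    obtain ⟨x, hx⟩ := P.1.nonempty_of_mem_parts hB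
    obtain ⟨C, hC, hxC, -⟩ := h x x ⟨B, hB, hx, hx⟩
    refine ⟨C, hC, fun y hy => ?_⟩
    obtain ⟨C', hC', hxC', hyC'⟩ := h x y ⟨B, hB, hx, hy⟩
    obtain rfl := Q.1.eq_of_mem_parts hC hC' hxC hxC'
    exact hyC'

theorem ext_rel (h : ∀ x y, P.Rel x y ↔ Q.Rel x y) : P = Q :=
  le_antisymm (le_iff_rel.2 fun x y => (h x y).1) (le_iff_rel.2 fun x y => (h x y).2)

/-- A non-crossing equivalence relation on `[n]` comes from a non-crossing partition. -/
theorem exists_rel (n : ℕ) (r : ℕ → ℕ → Prop) (refl : ∀ x, x ∈ Finset.Icc 1 n → r x x)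
    (mem : ∀ x y, r x y → x ∈ Finset.Icc 1 n) (symm : ∀ x y, r x y → r y x)
    (trans : ∀ x y z, r x y → r y z → r x z)
    (cross : ∀ w x y z, w < x → x < y → y < z → r w y → r x z → r w x) :
    ∃ P : NCP n, ∀ x y, P.Rel x y ↔ r x y := by
  classical
  let f : ℕ → Finset ℕ := fun x => (Finset.Icc 1 n).filter (r x)
  have hf : ∀ x y, y ∈ f x ↔ r x y := fun x y => by
    simp only [f, Finset.mem_filter, and_iff_right_iff_imp]
    exact fun h => mem _ _ (symm _ _ h)
  let F : Finpartition (Finset.Icc 1 n) := Finpartition.ofExistsUnique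
    ((Finset.Icc 1 n).image f)
    (by
      intro p hp
      obtain ⟨x, -, rfl⟩ := Finset.mem_image.1 hp
      exact Finset.filter_subset _ _)
    (by
      intro x hx
      refine ⟨f x, ⟨Finset.mem_image_of_mem _ hx, (hf _ _).2 (refl _ hx)⟩, ?_⟩
      rintro p ⟨hp, hxp⟩
      obtain ⟨y, -, rfl⟩ := Finset.mem_image.1 hp
      rw [hf] at hxp
      ext z
      rw [hf, hf]
      exact ⟨trans _ _ _ (symm _ _ hxp), trans _ _ _ hxp⟩)
    (by
      intro h
      obtain ⟨x, hx, hx'⟩ := Finset.mem_image.1 h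
      exact Finset.notMem_empty x (hx' ▸ (hf _ _).2 (refl _ hx)))
  have key : ∀ x y, (∃ B ∈ F.parts, x ∈ B ∧ y ∈ B) ↔ r x y := by
    intro x y
    constructor
    · rintro ⟨B, hB, hx, hy⟩
      obtain ⟨u, -, rfl⟩ := Finset.mem_image.1 hB
      rw [hf] at hx hy
      exact trans _ _ _ (symm _ _ hx) hy
    · intro h
      exact ⟨f x, Finset.mem_image_of_mem _ (mem _ _ h), (hf _ _).2 (refl _ (mem _ _ h)),
        (hf _ _).2 h⟩
  refine ⟨⟨F, ?_⟩, key⟩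
  intro B hB C hC w x y z h1 h2 h3 hw hy hx hz
  have := cross w x y z h1 h2 h3 ((key _ _).1 ⟨B, hB, hw, hy⟩) ((key _ _).1 ⟨C, hC, hx, hz⟩)
  obtain ⟨D, hD, hwD, hxD⟩ := (key _ _).2 this
  rw [F.eq_of_mem_parts hB hD hw hwD, F.eq_of_mem_parts hC hD hx hxD]

/-- The element `x` is not the minimum of its block. -/
def NonMin (P : NCP n) (x : ℕ) : Prop := ∃ y, y < x ∧ P.Rel y x

open Classical in
/-- The elements that are not the minimum of their block. -/
noncomputable def nonMins (P : NCP n) : Finset ℕ := (Finset.Icc 1 n).filter P.NonMin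

theorem mem_nonMins : x ∈ P.nonMins ↔ P.NonMin x := by
  classical
  simp only [nonMins, Finset.mem_filter, and_iff_right_iff_imp]
  rintro ⟨y, -, h⟩
  exact h.mem_right

theorem exists_min (P : NCP n) (hx : x ∈ Finset.Icc 1 n) :
    ∃ y, P.Rel y x ∧ ¬ P.NonMin y ∧ ∀ z, P.Rel z x → y ≤ z := by
  classical
  have hex : ∃ y, P.Rel y x := ⟨x, P.rel_refl hx⟩
  refine ⟨Nat.find hex, Nat.find_spec hex, ?_, fun z hz => Nat.find_min' hex hz⟩
  rintro ⟨y, hy, h⟩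
  exact Nat.find_min hex hy (h.trans (Nat.find_spec hex))

/-- The rank of `P`: `n` minus the number of blocks. -/
noncomputable def rank (P : NCP n) : ℕ := P.nonMins.card

theorem NonMin.mono (h : P ≤ Q) (hx : P.NonMin x) : Q.NonMin x := by
  obtain ⟨y, hy, h'⟩ := hx
  exact ⟨y, hy, le_iff_rel.1 h _ _ h'⟩

/-- A block of `Q` that contains two blocks of `P` turns the larger of their minima into a
non-minimum. So coarsening strictly always creates new non-minima, which makes the rank strictly
monotone. -/
theorem eq_of_le_of_nonMin (h : P ≤ Q) (h' : ∀ x, Q.NonMin x → P.NonMin x) : P = Q := by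
  refine le_antisymm h (le_iff_rel.2 fun x y hxy => ?_)
  obtain ⟨u, hu, hu', -⟩ := P.exists_min hxy.mem_left
  obtain ⟨v, hv, hv', -⟩ := P.exists_min hxy.mem_right
  have huv : Q.Rel u v :=
    ((le_iff_rel.1 h _ _ hu).trans hxy).trans (le_iff_rel.1 h _ _ hv).symm
  rcases lt_trichotomy u v with hlt | rfl | hlt
  · exact (hv' (h' _ ⟨u, hlt, huv⟩)).elim
  · exact hu.symm.trans hv
  · exact (hu' (h' _ ⟨v, hlt, huv.symm⟩)).elim

theorem rank_strictMono : StrictMono (rank (n := n)) := by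
  intro P Q h
  refine Finset.card_lt_card (Finset.ssubset_iff_subset_ne.2 ⟨fun x hx => ?_, fun heq => ?_⟩)
  · rw [mem_nonMins] at hx ⊢
    exact hx.mono h.le
  · refine h.ne (eq_of_le_of_nonMin h.le fun x hx => ?_)
    rw [← mem_nonMins] at hx ⊢
    rwa [heq]

theorem nonMins_subset (P : NCP n) : P.nonMins ⊆ Finset.Icc 2 n := by
  intro x hx
  rw [mem_nonMins] at hx
  obtain ⟨y, hy, h⟩ := hx
  have h1 := Finset.mem_Icc.1 h.mem_left
  have h2 := Finset.mem_Icc.1 h.mem_right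
  exact Finset.mem_Icc.2 ⟨by omega, h2.2⟩

theorem rank_le (P : NCP n) : P.rank ≤ n - 1 := by
  have := Finset.card_le_card P.nonMins_subset
  rw [Nat.card_Icc] at this
  unfold rank
  omega

theorem exists_bot (n : ℕ) : ∃ P : NCP n, (∀ Q, P ≤ Q) ∧ (∀ x y, P.Rel x y → x = y) := by
  obtain ⟨P, hP⟩ := exists_rel n (fun x y => x = y ∧ x ∈ Finset.Icc 1 n) (by simp) (by simp)
    (by rintro x y ⟨rfl, h⟩; exact ⟨rfl, h⟩) (by rintro x y z ⟨rfl, h⟩ ⟨rfl, -⟩; exact ⟨rfl, h⟩)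
    (by intros; omega)
  refine ⟨P, fun Q => le_iff_rel.2 fun x y h => ?_, fun x y h => ((hP _ _).1 h).1⟩
  obtain ⟨rfl, hx⟩ := (hP _ _).1 h
  exact Q.rel_refl hx

theorem exists_top (n : ℕ) : ∃ P : NCP n, (∀ Q, Q ≤ P) ∧ P.rank = n - 1 := by
  obtain ⟨P, hP⟩ := exists_rel n (fun x y => x ∈ Finset.Icc 1 n ∧ y ∈ Finset.Icc 1 n)
    (by simp) (by simp +contextual) (by simp +contextual) (by simp +contextual) (by
      intro w x y z _ _ _ h h'; exact ⟨h.1, h'.1⟩)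
  refine ⟨P, fun Q => le_iff_rel.2 fun x y h => (hP _ _).2 ⟨h.mem_left, h.mem_right⟩, ?_⟩
  have : P.nonMins = Finset.Icc 2 n := by
    refine P.nonMins_subset.antisymm fun x hx => mem_nonMins.2 ⟨1, ?_, (hP _ _).2 ?_⟩
    · have := Finset.mem_Icc.1 hx; omega
    · rw [Finset.mem_Icc] at *
      simp only [Finset.mem_Icc]; omega
  rw [rank, this, Nat.card_Icc]
  omega

/-! ### Elementary merges and their labels -/

/-- `Q` is obtained from `P` by merging the block with minimum `b` into the block of `a`, where
`a` is the largest element below `b` of its block. -/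
structure Step (P Q : NCP n) (a b : ℕ) : Prop where
  lt : a < b
  min : ¬ P.NonMin b
  gap : ∀ x, P.Rel a x → x ≤ a ∨ b < x
  mem_left : a ∈ Finset.Icc 1 n
  mem_right : b ∈ Finset.Icc 1 n
  rel : ∀ x y, Q.Rel x y ↔ P.Rel x y ∨ (P.Rel x a ∧ P.Rel y b) ∨ (P.Rel x b ∧ P.Rel y a)

theorem Step.rel_labels (h : Step P Q a b) : Q.Rel a b :=
  (h.rel _ _).2 (.inr (.inl ⟨P.rel_refl h.mem_left, P.rel_refl h.mem_right⟩))

theorem Step.le (h : Step P Q a b) : P ≤ Q := le_iff_rel.2 fun x y h' => (h.rel x y).2 (.inl h')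

theorem Step.min_le (h : Step P Q a b) (h' : P.Rel x b) : b ≤ x :=
  not_lt.1 fun hlt => h.min ⟨x, hlt, h'⟩

theorem Step.nonMin_iff (h : Step P Q a b) : Q.NonMin x ↔ P.NonMin x ∨ x = b := by
  constructor
  · rintro ⟨y, hy, hyx⟩
    rcases (h.rel _ _).1 hyx with h1 | ⟨h1, h2⟩ | ⟨h1, h2⟩
    · exact .inl ⟨y, hy, h1⟩
    · by_cases hxb : x = b
      · exact .inr hxb
      · exact .inl ⟨b, lt_of_le_of_ne (h.min_le h2) (Ne.symm hxb), h2.symm⟩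
    · exact .inl ⟨a, h.lt.trans_le ((h.min_le h1).trans hy.le), h2.symm⟩
  · rintro (hx | rfl)
    · exact hx.mono h.le
    · exact ⟨a, h.lt, h.rel_labels⟩

theorem Step.rank (h : Step P Q a b) : Q.rank = P.rank + 1 := by
  have : Q.nonMins = insert b P.nonMins := by
    ext x
    rw [Finset.mem_insert, mem_nonMins, mem_nonMins, h.nonMin_iff, or_comm]
  rw [NCP.rank, this, Finset.card_insert_of_notMem (by rw [mem_nonMins]; exact h.min), NCP.rank]

theorem Step.right_unique (h : Step P Q a b) (h' : Step P R a b) : Q = R :=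
  ext_rel fun x y => by rw [h.rel, h'.rel]

theorem Step.le_label (h : Step P Q a b) (h' : Q.Rel x b) (hx : x < b) : P.Rel x a := by
  rcases (h.rel _ _).1 h' with h1 | ⟨h1, -⟩ | ⟨h1, -⟩
  · exact absurd (h.min_le h1) (not_le.2 hx)
  · exact h1
  · exact absurd (h.min_le h1) (not_le.2 hx)

/-- `b` is the only element that stops being a block minimum. All elements below `b` of its new
block come from the block of `a`, and `gap` makes `a` the largest of them. -/
theorem Step.labels_unique (h : Step P Q a b) (h' : Step P Q a' b') : a = a' ∧ b = b' := by
  have hb : b = b' := by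
    have h1 : Q.NonMin b := h.nonMin_iff.2 (.inr rfl)
    rcases h'.nonMin_iff.1 h1 with h2 | h2
    · exact (h.min h2).elim
    · exact h2
  subst hb
  refine ⟨le_antisymm ?_ ?_, rfl⟩
  · have := h'.gap a (h'.le_label h.rel_labels h.lt).symm
    have := h.lt
    omega
  · have := h.gap a' (h.le_label h'.rel_labels h'.lt).symm
    have := h'.lt
    omega

/-- A merge that satisfies the label conditions and keeps the partition non-crossing is a step. -/
theorem exists_step (hlt : a < b) (hmin : ¬ P.NonMin b) (hgap : ∀ x, P.Rel a x → x ≤ a ∨ b < x)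
    (ha : a ∈ Finset.Icc 1 n) (hb : b ∈ Finset.Icc 1 n)
    (hleft : ∀ w x y z, w < x → x < y → y < z → P.Rel x z → ¬ P.Rel x a → ¬ P.Rel x b →
      ¬ ((P.Rel w a ∧ P.Rel y b) ∨ (P.Rel w b ∧ P.Rel y a)))
    (hright : ∀ w x y z, w < x → x < y → y < z → P.Rel w y → ¬ P.Rel w a → ¬ P.Rel w b →
      ¬ ((P.Rel x a ∧ P.Rel z b) ∨ (P.Rel x b ∧ P.Rel z a))) :
    ∃ Q, Step P Q a b := by
  obtain ⟨Q, hQ⟩ := exists_rel n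
    (fun x y => P.Rel x y ∨ (P.Rel x a ∧ P.Rel y b) ∨ (P.Rel x b ∧ P.Rel y a))
    (fun x hx => .inl (P.rel_refl hx))
    (by rintro x y (h | h | h) <;> first | exact h.mem_left | exact h.1.mem_left)
    (by rintro x y (h | h | h)
        · exact .inl h.symm
        · exact .inr (.inr h.symm)
        · exact .inr (.inl h.symm))
    (by rintro x y z (h | h | h) (h' | h' | h')
        · exact .inl (h.trans h')
        · exact .inr (.inl ⟨h.trans h'.1, h'.2⟩)
        · exact .inr (.inr ⟨h.trans h'.1, h'.2⟩)
        · exact .inr (.inl ⟨h.1, h'.symm.trans h.2⟩)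
        · exact .inr (.inl ⟨h.1, h'.2⟩)
        · exact .inl (h.1.trans h'.2.symm)
        · exact .inr (.inr ⟨h.1, h'.symm.trans h.2⟩)
        · exact .inl (h.1.trans h'.2.symm)
        · exact .inr (.inr ⟨h.1, h'.2⟩))
    -- Only a block meeting neither `a` nor `b` can cross the merged block. It occupies either the
    -- inner pair `x, z` or the outer pair `w, y` of the pattern, which are the cases of `hleft` and
    -- `hright`.
    (by
      intro w x y z h1 h2 h3 hwy hxz
      have hl := hleft w x y z h1 h2 h3
      have hr := hright w x y z h1 h2 h3
      have hc := P.rel_cross h1 h2 h3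
      by_cases hxa : P.Rel x a
      · rcases hwy with h | h | h
        · by_cases hwa : P.Rel w a
          · exact .inl (hwa.trans hxa.symm)
          by_cases hwb : P.Rel w b
          · exact .inr (.inr ⟨hwb, hxa⟩)
          rcases hxz with h' | h'
          · exact .inl (hc h h')
          · exact (hr h hwa hwb h').elim
        · exact .inl (h.1.trans hxa.symm)
        · exact .inr (.inr ⟨h.1, hxa⟩)
      by_cases hxb : P.Rel x b
      · rcases hwy with h | h | h
        · by_cases hwa : P.Rel w a
          · exact .inr (.inl ⟨hwa, hxb⟩)
          by_cases hwb : P.Rel w b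
          · exact .inl (hwb.trans hxb.symm)
          rcases hxz with h' | h'
          · exact .inl (hc h h')
          · exact (hr h hwa hwb h').elim
        · exact .inr (.inl ⟨h.1, hxb⟩)
        · exact .inl (h.1.trans hxb.symm)
      have hxz' : P.Rel x z := by tauto
      rcases hwy with h | h
      · exact .inl (hc h hxz')
      · exact (hl hxz' hxa hxb h).elim)
  exact ⟨Q, hlt, hmin, hgap, ha, hb, hQ⟩

/-- Below any larger partition there is a step. -/
theorem exists_step_of_lt (h : P < Q) : ∃ R a b, Step P R a b ∧ R ≤ Q := by
  classical
  have hPQ := le_iff_rel.1 h.le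
  obtain ⟨x, hx, hx'⟩ : ∃ x, Q.NonMin x ∧ ¬ P.NonMin x := by
    by_contra! hcon
    exact h.ne (eq_of_le_of_nonMin h.le hcon)
  have hxm : x ∈ Finset.Icc 1 n := by
    obtain ⟨y, -, h⟩ := hx
    exact h.mem_right
  obtain ⟨m, hmx, hm, hmin⟩ := Q.exists_min hxm
  -- In a block of `Q` that is split in `P`, `b` is the least element outside the `P`-block of the
  -- minimum `m`, and `a` will be the last element of that `P`-block before `b`.
  have hex : ∃ b, Q.Rel m b ∧ ¬ P.Rel m b := by
    refine ⟨x, hmx, fun h => hx' ⟨m, lt_of_le_of_ne (hmin _ (Q.rel_refl hxm)) ?_, h⟩⟩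
    rintro rfl
    exact hm hx
  obtain ⟨hb, hb'⟩ := Nat.find_spec hex
  have hbmin : ∀ y, Q.Rel m y → y < Nat.find hex → P.Rel m y := fun y hy hlt => by
    have := Nat.find_min hex hlt
    tauto
  generalize Nat.find hex = b at hb hb' hbmin
  have hmb : m < b := by
    refine lt_of_le_of_ne (hmin _ (hb.symm.trans hmx)) ?_
    rintro rfl
    exact hb' (P.rel_refl hb.mem_left)
  have hmm : m ∈ Finset.Icc 1 n := hb.mem_left
  let a := Nat.findGreatest (fun y => P.Rel m y) (b - 1)
  have ha : P.Rel m a :=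
    Nat.findGreatest_spec (P := fun y => P.Rel m y) (m := m) (by omega) (P.rel_refl hmm)
  have hab : a < b := by
    have : a ≤ b - 1 := Nat.findGreatest_le _
    omega
  have hgap : ∀ x, P.Rel a x → x ≤ a ∨ b < x := by
    intro y hy
    by_contra! hcon
    rcases hcon.2.lt_or_eq with hlt | rfl
    · exact Nat.findGreatest_is_greatest hcon.1 (by omega) (ha.trans hy)
    · exact hb' (ha.trans hy)
  have hbm : ∀ y, P.Rel y b → b ≤ y := by
    intro y hy
    by_contra! hcon
    exact hb' ((hbmin y (hb.trans (hPQ _ _ hy.symm)) hcon).trans hy)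
  have hQab : Q.Rel a b := (hPQ _ _ ha).symm.trans hb
  have hQm : ∀ y, Q.Rel y b → m ≤ y := fun y hy => hmin _ (hy.trans (hb.symm.trans hmx))
  -- A third block of `P` crossing the merged one lies in the same block of `Q`, since `Q` is
  -- non-crossing. By the choice of `b` its elements come after `b`, and then it already crosses the
  -- block of `m` or of `b` in `P`.
  have key : ∀ u, ¬ P.Rel u a → Q.Rel u b → b ≤ u := by
    intro u hu hub
    by_contra! hcon
    exact hu ((hbmin u (hb.trans hub.symm) hcon).symm.trans ha)
  have hleast : ∀ y, P.Rel y a → m ≤ y := fun y hy => hQm y ((hPQ _ _ hy).trans hQab)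
  obtain ⟨R, hR⟩ : ∃ R, Step P R a b := by
    refine exists_step hab ?_ hgap ha.mem_right hb.mem_right ?_ ?_
    · rintro ⟨y, hy, hyb⟩
      exact absurd (hbm y hyb) (by omega)
    · intro w x y z h1 h2 h3 hxz hxa hxb hwy
      have hwyQ : Q.Rel w b ∧ Q.Rel y b := by
        rcases hwy with h | h
        · exact ⟨(hPQ _ _ h.1).trans hQab, hPQ _ _ h.2⟩
        · exact ⟨(hPQ _ _ h.1), (hPQ _ _ h.2).trans hQab⟩
      have hxQ : Q.Rel x b :=
        (Q.rel_cross h1 h2 h3 (hwyQ.1.trans hwyQ.2.symm) (hPQ _ _ hxz)).symm.trans hwyQ.1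
      have hbx : b ≤ x := key x hxa hxQ
      have hbx : b < x := lt_of_le_of_ne hbx (by rintro rfl; exact hxb (P.rel_refl hb.mem_right))
      rcases hwy with h | h
      · exact hxb (P.rel_cross hbx h2 h3 h.2.symm hxz).symm
      · exact hxa ((P.rel_cross (hmb.trans hbx) h2 h3 (ha.trans h.2.symm) hxz).symm.trans ha)
    · intro w x y z h1 h2 h3 hwy hwa hwb hxz
      have hxzQ : Q.Rel x b ∧ Q.Rel z b := by
        rcases hxz with h | h
        · exact ⟨(hPQ _ _ h.1).trans hQab, hPQ _ _ h.2⟩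
        · exact ⟨(hPQ _ _ h.1), (hPQ _ _ h.2).trans hQab⟩
      have hwQ : Q.Rel w b :=
        (Q.rel_cross h1 h2 h3 (hPQ _ _ hwy) (hxzQ.1.trans hxzQ.2.symm)).trans hxzQ.1
      have hbw : b ≤ w := key w hwa hwQ
      have hbw : b < w := lt_of_le_of_ne hbw (by rintro rfl; exact hwb (P.rel_refl hb.mem_right))
      rcases hxz with h | h
      · exact hwa ((P.rel_cross (hmb.trans hbw) h1 h2 (ha.trans h.1.symm) hwy).symm.trans ha)
      · exact hwb (P.rel_cross hbw h1 h2 h.1.symm hwy).symm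
  refine ⟨R, a, b, hR, le_iff_rel.2 fun x y hxy => ?_⟩
  rcases (hR.rel _ _).1 hxy with h | h | h
  · exact hPQ _ _ h
  · exact ((hPQ _ _ h.1).trans hQab).trans (hPQ _ _ h.2).symm
  · exact ((hPQ _ _ h.1).trans hQab.symm).trans (hPQ _ _ h.2).symm

theorem exists_step_of_le_of_rank (h : P ≤ Q) (hr : Q.rank = P.rank + 1) : ∃ a b, Step P Q a b := by
  have hlt : P < Q := lt_of_le_of_ne h (by rintro rfl; omega)
  obtain ⟨R, a, b, hR, hRQ⟩ := exists_step_of_lt hlt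
  obtain rfl | hlt := hRQ.eq_or_lt
  · exact ⟨a, b, hR⟩
  · have := rank_strictMono hlt
    have := hR.rank
    omega

end NCP

/-! ### Maximal chains as sequences of merges -/

namespace NCP

variable {n : ℕ} {a b a' b' : Fin (n - 1) → ℕ} {C C' : Flag (NCP n)} {P Q : NCP n}

/-- The elements of `C` are `x₀, …, xₙ₋₁`, related by steps with labels `(aᵢ, bᵢ)`. -/
def HasStepLabels (C : Flag (NCP n)) (a b : Fin (n - 1) → ℕ) : Prop :=
  ∃ x : ℕ → NCP n, C.carrier = x '' Set.Iio n ∧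
    ∀ i : Fin (n - 1), Step (x i) (x (i + 1)) (a i) (b i)

theorem eq_of_mem_flag (hP : P ∈ C) (hQ : Q ∈ C) (h : P.rank = Q.rank) : P = Q := by
  rcases C.le_or_le hP hQ with h' | h' <;> rcases h'.eq_or_lt with h' | h'
  · exact h'
  · exact absurd h (rank_strictMono h').ne
  · exact h'.symm
  · exact absurd h (rank_strictMono h').ne'

theorem exists_mem_flag (C : Flag (NCP n)) (k : ℕ) (hk : k ≤ n - 1) : ∃ P ∈ C, P.rank = k := by
  induction k with
  | zero =>
    obtain ⟨P, hP, hP'⟩ := exists_bot n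
    refine ⟨P, Flag.mem_iff_forall_le_or_ge.2 fun Q _ => .inl (hP Q), ?_⟩
    rw [rank, Finset.card_eq_zero, Finset.eq_empty_iff_forall_notMem]
    intro x hx
    obtain ⟨y, hy, h⟩ := mem_nonMins.1 hx
    exact hy.ne (hP' _ _ h)
  | succ k ih =>
    obtain ⟨P, hPC, hP⟩ := ih (by omega)
    have hex : ∃ r, ∃ Q ∈ C, k < Q.rank ∧ Q.rank = r := by
      obtain ⟨T, hT, hTr⟩ := exists_top n
      exact ⟨_, T, Flag.mem_iff_forall_le_or_ge.2 fun Q _ => .inr (hT Q), by omega, rfl⟩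
    classical
    obtain ⟨Q, hQC, hkQ, hQr⟩ := Nat.find_spec hex
    have hQmin : ∀ R ∈ C, k < R.rank → Q.rank ≤ R.rank := fun R hR hkR => by
      rw [hQr]
      exact Nat.find_min' hex ⟨R, hR, hkR, rfl⟩
    have hle : ∀ R S : NCP n, R ∈ C → S ∈ C → R.rank ≤ S.rank → R ≤ S := fun R S hR hS h => by
      rcases C.le_or_le hR hS with h' | h'
      · exact h'
      · exact (eq_of_mem_flag hR hS (le_antisymm h (rank_strictMono.monotone h'))).le
    have hPQ : P < Q := lt_of_le_of_ne (hle P Q hPC hQC (by omega)) (by rintro rfl; omega)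
    obtain ⟨R, a, b, hR, hRQ⟩ := exists_step_of_lt hPQ
    -- `Q` has the least rank above `k` in `C`, so `R`, which lies between `P` and `Q`, is
    -- comparable to every member of the chain. Maximality puts it in `C`.
    refine ⟨R, Flag.mem_iff_forall_le_or_ge.2 fun S hS => ?_, by rw [hR.rank, hP]⟩
    rcases le_or_gt S.rank k with h | h
    · exact .inr ((hle S P hS hPC (by omega)).trans hR.le)
    · exact .inl (hRQ.trans (hle Q S hQC hS (hQmin S hS h)))

theorem exists_hasStepLabels (hn : 1 ≤ n) (C : Flag (NCP n)) : ∃ a b, HasStepLabels C a b := by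
  have h : ∀ k, ∃ P, k ≤ n - 1 → P ∈ C ∧ P.rank = k := fun k => by
    by_cases hk : k ≤ n - 1
    · obtain ⟨P, hP⟩ := exists_mem_flag C k hk
      exact ⟨P, fun _ => hP⟩
    -- An arbitrary value: only the indices up to `n - 1` matter.
    · exact ⟨(exists_bot n).choose, fun h => (hk h).elim⟩
  choose x hx using h
  have hstep : ∀ i : Fin (n - 1), ∃ a b, Step (x i) (x (i + 1)) a b := by
    intro i
    obtain ⟨h1, h2⟩ := hx i (by omega)
    obtain ⟨h3, h4⟩ := hx (i + 1) (by omega)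
    refine exists_step_of_le_of_rank ?_ (by omega)
    rcases C.le_or_le h1 h3 with h | h
    · exact h
    · have := rank_strictMono.monotone h
      omega
  choose a b hab using hstep
  refine ⟨a, b, x, ?_, hab⟩
  ext P
  constructor
  · intro hP
    have hr := P.rank_le
    exact ⟨P.rank, Set.mem_Iio.2 (by omega), eq_of_mem_flag (hx _ hr).1 hP (hx _ hr).2⟩
  · rintro ⟨k, hk, rfl⟩
    exact (hx k (by have := Set.mem_Iio.1 hk; omega)).1

/-- The `n - 1` steps raise the rank by `n - 1`, which is also the largest possible rank, so the
sequence has to start at rank `0`. -/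
theorem rank_of_steps {x : ℕ → NCP n} (hx : ∀ i : Fin (n - 1), Step (x i) (x (i + 1)) (a i) (b i))
    (k : ℕ) (hk : k ≤ n - 1) : (x k).rank = k := by
  have h : ∀ k ≤ n - 1, (x k).rank = (x 0).rank + k := by
    intro k
    induction k with
    | zero => simp
    | succ k ih =>
      intro hk
      rw [(hx ⟨k, by omega⟩).rank, ih (by omega)]
      rfl
  have h1 := h (n - 1) le_rfl
  have h2 := (x (n - 1)).rank_le
  have h3 := h k hk
  omega

theorem HasStepLabels.unique (hn : 1 ≤ n) (h : HasStepLabels C a b) (h' : HasStepLabels C a' b') :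
    a = a' ∧ b = b' := by
  obtain ⟨x, hxC, hx⟩ := h
  obtain ⟨y, hyC, hy⟩ := h'
  have hxy : ∀ k ≤ n - 1, x k = y k := fun k hk => by
    refine eq_of_mem_flag (C := C) ?_ ?_ ((rank_of_steps hx k hk).trans (rank_of_steps hy k hk).symm)
    · exact hxC.symm.subset ⟨k, Set.mem_Iio.2 (by omega), rfl⟩
    · exact hyC.symm.subset ⟨k, Set.mem_Iio.2 (by omega), rfl⟩
  have : ∀ i, a i = a' i ∧ b i = b' i := fun i => by
    have h1 := hx i
    rw [hxy _ (by omega), hxy _ (by omega)] at h1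
    exact h1.labels_unique (hy i)
  exact ⟨funext fun i => (this i).1, funext fun i => (this i).2⟩

theorem eq_of_rank_eq_zero (hP : P.rank = 0) (hQ : Q.rank = 0) : P = Q := by
  obtain ⟨R, hR, -⟩ := exists_bot n
  have : ∀ S : NCP n, S.rank = 0 → S = R := fun S hS => by
    rcases (hR S).eq_or_lt with h | h
    · exact h.symm
    · have := rank_strictMono h
      omega
  rw [this P hP, this Q hQ]

theorem HasStepLabels.flag_unique (hn : 1 ≤ n) (h : HasStepLabels C a b)
    (h' : HasStepLabels C' a b) : C = C' := by
  obtain ⟨x, hxC, hx⟩ := h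
  obtain ⟨y, hyC, hy⟩ := h'
  have hxy : ∀ k, k ≤ n - 1 → x k = y k := fun k => by
    induction k with
    | zero =>
      intro _
      exact eq_of_rank_eq_zero (rank_of_steps hx 0 (by omega)) (rank_of_steps hy 0 (by omega))
    | succ k ih =>
      intro hk
      have h1 := hx ⟨k, by omega⟩
      have h2 := hy ⟨k, by omega⟩
      simp only at h1 h2
      rw [ih (by omega)] at h1
      exact h1.right_unique h2
  refine Flag.ext ?_
  change C.carrier = C'.carrier
  rw [hxC, hyC]
  refine Set.image_congr fun k hk => hxy k ?_
  have := Set.mem_Iio.1 hk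
  omega

/-- The sequence has a member of every rank. A further element comparable to all of them would have
the rank of one of them, against strict monotonicity of the rank. -/
theorem exists_flag_of_steps (hn : 1 ≤ n) {x : ℕ → NCP n}
    (hx : ∀ i : Fin (n - 1), Step (x i) (x (i + 1)) (a i) (b i)) :
    ∃ C : Flag (NCP n), HasStepLabels C a b := by
  have hr := rank_of_steps hx
  have hmono : ∀ k, ∀ l, l ≤ n - 1 → k ≤ l → x k ≤ x l := fun k l => by
    induction l with
    | zero => intro _ h; rw [Nat.le_zero.1 h]
    | succ l ih =>
      intro hl hkl
      rcases hkl.eq_or_lt with rfl | hkl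
      · exact le_rfl
      · exact (ih (by omega) (by omega)).trans (hx ⟨l, by omega⟩).le
  have hchain : IsChain (· ≤ ·) (x '' Set.Iio n) := by
    rintro _ ⟨k, hk, rfl⟩ _ ⟨l, hl, rfl⟩ -
    rw [Set.mem_Iio] at hk hl
    rcases le_total k l with h | h
    · exact .inl (hmono k l (by omega) h)
    · exact .inr (hmono l k (by omega) h)
  refine ⟨⟨x '' Set.Iio n, hchain, fun s hs hsub => hsub.antisymm fun P hP => ?_⟩, x, rfl, hx⟩
  have hPr := P.rank_le
  have hk : x P.rank ∈ x '' Set.Iio n := ⟨P.rank, Set.mem_Iio.2 (by omega), rfl⟩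
  have hrk := hr P.rank hPr
  by_cases heq : x P.rank = P
  · rwa [heq] at hk
  · rcases hs (hsub hk) hP heq with h | h
    · exact absurd hrk (rank_strictMono (lt_of_le_of_ne h heq)).ne
    · exact absurd hrk (rank_strictMono (lt_of_le_of_ne h (Ne.symm heq))).ne'

end NCP

/-! ### Label sequences of chains -/

/-- The label sequences of maximal chains: the edges `(aₜ, bₜ)` form a non-crossing tree on
`[m + 1]` in which each `bₜ` has the parent `aₜ`, and larger siblings come first. -/
structure IsTreeLabeling {m : ℕ} (a b : Fin m → ℕ) : Prop where
  inj : Function.Injective b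
  pos : ∀ t, 1 ≤ a t
  lt : ∀ t, a t < b t
  le : ∀ t, b t ≤ m + 1
  order : ∀ s t, b t < b s → a s < b t → a s < a t ∨ (a s = a t ∧ s < t)

namespace NCP

variable {n : ℕ} {a b : Fin (n - 1) → ℕ} {C : Flag (NCP n)}

theorem HasStepLabels.isTreeLabeling (hn : 1 ≤ n) (h : HasStepLabels C a b) :
    IsTreeLabeling a b := by
  obtain ⟨x, -, hx⟩ := h
  have hmono : ∀ k l, l ≤ n - 1 → k ≤ l → x k ≤ x l := fun k l => by
    induction l with
    | zero => intro _ h; rw [Nat.le_zero.1 h]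
    | succ l ih =>
      intro hl hkl
      rcases hkl.eq_or_lt with rfl | hkl
      · exact le_rfl
      · exact (ih (by omega) (by omega)).trans (hx ⟨l, by omega⟩).le
  have hlate : ∀ s t : Fin (n - 1), s < t → (x t).Rel (a s) (b s) := fun s t hst =>
    le_iff_rel.1 (hmono (s + 1) t (by omega) hst) _ _ (hx s).rel_labels
  have hne : ∀ s t, s < t → b s ≠ b t := fun s t hst heq =>
    (hx t).min ⟨a s, heq ▸ (hx s).lt, heq ▸ hlate s t hst⟩
  refine ⟨fun s t hst => ?_, fun t => (Finset.mem_Icc.1 (hx t).mem_left).1, fun t => (hx t).lt,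
    fun t => ?_, fun s t hb ha => ?_⟩
  · rcases lt_trichotomy s t with h | h | h
    · exact (hne s t h hst).elim
    · exact h
    · exact (hne t s h hst.symm).elim
  · have := (Finset.mem_Icc.1 (hx t).mem_right).2
    omega
  · have hst : s ≠ t := by rintro rfl; omega
    rcases lt_trichotomy (a s) (a t) with h | h | h
    · exact .inl h
    -- Had `t` come first, `b t` would already lie in the block of `a s`, strictly between `a s` and
    -- `b s`.
    · refine .inr ⟨h, ?_⟩
      by_contra hcon
      have h1 := hlate t s (lt_of_le_of_ne (not_lt.1 hcon) hst.symm)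
      rw [← h] at h1
      have := (hx s).gap _ h1
      omega
    -- The arcs cross: `a t < a s < b t < b s`. After the later of the two steps non-crossing puts
    -- all four elements into one block. So before that step the block of its `a` contained an
    -- element strictly between its two labels, contrary to `gap`.
    · exfalso
      rcases lt_or_gt_of_ne hst with hlt | hlt
      · have h1 := le_iff_rel.1 (hx t).le _ _ (hlate s t hlt)
        have h2 := (x (t + 1)).rel_cross h ha hb (hx t).rel_labels h1
        have h3 := (hx t).le_label (h2.symm.trans (hx t).rel_labels) ha
        have := (hx t).gap _ h3.symm
        omega
      · have h1 := le_iff_rel.1 (hx s).le _ _ (hlate t s hlt)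
        have h2 := (x (s + 1)).rel_cross h ha hb h1 (hx s).rel_labels
        have h3 := (hx s).le_label ((h1.symm.trans h2).trans (hx s).rel_labels) hb
        have := (hx s).gap _ h3.symm
        omega

/-- The blocks of `P` have the minima prescribed by the first `i` labels, and no block is split by
the open interval of a later label. -/
def Compatible (a b : Fin (n - 1) → ℕ) (i : ℕ) (P : NCP n) : Prop :=
  (∀ x, P.NonMin x ↔ ∃ t : Fin (n - 1), t < i ∧ b t = x) ∧
    ∀ s : Fin (n - 1), i ≤ s → ∀ x y, P.Rel x y →
      (a s < x ∧ x < b s ↔ a s < y ∧ y < b s)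

/-- The first half of the invariant keeps `b i` a block minimum. The second half, for the interval
of `i` itself, gives `gap` and prevents crossings. It survives the merge because `order` places `a
i` and `b i` both inside or both outside each later interval. -/
theorem Compatible.exists_step (h : IsTreeLabeling a b) {i : Fin (n - 1)} {P : NCP n}
    (hP : Compatible a b i P) : ∃ Q, Step P Q (a i) (b i) ∧ Compatible a b (i + 1) Q := by
  obtain ⟨hmin, hint⟩ := hP
  have hb : ¬ P.NonMin (b i) := by
    rw [hmin]
    rintro ⟨t, ht, hti⟩
    have := h.inj hti
    omega
  have hlt := h.lt i
  have hble : ∀ y, P.Rel (b i) y → b i ≤ y := fun y hy => by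
    by_contra! hcon
    exact hb ⟨y, hcon, hy.symm⟩
  have hI := fun x y => hint i le_rfl x y
  have hpos := h.pos i
  have hle := h.le i
  have hain : a i ∈ Finset.Icc 1 n := Finset.mem_Icc.2 ⟨by omega, by omega⟩
  have hbin : b i ∈ Finset.Icc 1 n := Finset.mem_Icc.2 ⟨by omega, by omega⟩
  have hgap : ∀ x, P.Rel (a i) x → x ≤ a i ∨ b i < x := by
    intro x hx
    by_contra! hcon
    rcases hcon.2.eq_or_lt with rfl | h'
    · exact hb ⟨_, hlt, hx⟩
    · have := (hI _ _ hx).2 ⟨hcon.1, h'⟩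
      omega
  obtain ⟨Q, hQ⟩ : ∃ Q, Step P Q (a i) (b i) := by
    refine NCP.exists_step hlt hb hgap hain hbin ?_ ?_
    · rintro w x y z h1 h2 h3 hxz hxa hxb (⟨hw, hy⟩ | ⟨hw, hy⟩)
      · have hby := hble y hy.symm
        have hxi := hI _ _ hxz
        have c1 := fun h => P.rel_cross h h2 h3 hy.symm hxz
        have hne : x ≠ b i := by rintro rfl; exact hxb (P.rel_refl hbin)
        have hne' : x ≠ a i := by rintro rfl; exact hxa (P.rel_refl hain)
        by_cases hbx : b i < x
        · exact hxb (c1 hbx).symm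
        · have hxa' : x < a i := by omega
          exact hxa ((P.rel_cross h1 hxa' (by omega) hw hxz).symm.trans hw)
      · have hbw := hble w hw.symm
        exact hxa (P.rel_cross (by omega : a i < x) h2 h3 hy.symm hxz).symm
    · rintro w x y z h1 h2 h3 hwy hwa hwb (⟨hx, hz⟩ | ⟨hx, hz⟩)
      · have hbz := hble z hz.symm
        have hya : ¬ P.Rel y (a i) := fun h' => hwa (hwy.trans h')
        have hyb : ¬ P.Rel y (b i) := fun h' => hwb (hwy.trans h')
        have hwne : w ≠ a i := by rintro rfl; exact hwa (P.rel_refl hain)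
        have hyne : y ≠ a i := by rintro rfl; exact hya (P.rel_refl hain)
        have hwne' : w ≠ b i := by rintro rfl; exact hwb (P.rel_refl hbin)
        have hyne' : y ≠ b i := by rintro rfl; exact hyb (P.rel_refl hbin)
        have hI' := hI _ _ hwy
        have hg := hgap x hx.symm
        by_cases hbw : b i < w
        · exact hwa ((P.rel_cross (by omega : a i < w) h1 h2 hx.symm hwy).symm)
        by_cases hby : b i < y
        · exact hwb (P.rel_cross (by omega : w < b i) hby h3 hwy hz.symm)
        have hay : y < a i := by omega
        exact hwa ((P.rel_cross h1 h2 hay hwy hx).trans hx)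
      · have hbx := hble x hx.symm
        have hwne : w ≠ a i := by rintro rfl; exact hwa (P.rel_refl hain)
        have hwne' : w ≠ b i := by rintro rfl; exact hwb (P.rel_refl hbin)
        have hI' := hI _ _ hwy
        by_cases hwb' : w < b i
        · have hwa' : w < a i := by omega
          exact hwa (P.rel_cross hwa' (by omega) h3 hwy hz.symm)
        · exact hwb (P.rel_cross (by omega : b i < w) h1 h2 hx.symm hwy).symm
  refine ⟨Q, hQ, fun x => ?_, fun s hs x y hxy => ?_⟩
  · rw [hQ.nonMin_iff, hmin]
    constructor
    · rintro (⟨t, ht, rfl⟩ | rfl)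
      · exact ⟨t, by omega, rfl⟩
      · exact ⟨i, by omega, rfl⟩
    · rintro ⟨t, ht, rfl⟩
      by_cases hti : t = i
      · exact .inr (by rw [hti])
      · exact .inl ⟨t, by omega, rfl⟩
  · have hs' : (i : ℕ) ≤ s := by omega
    have hab : a s < a i ∧ a i < b s ↔ a s < b i ∧ b i < b s := by
      have h1 := h.order s i
      have h2 := h.order i s
      have h3 : b i ≠ b s := fun h' => by have := h.inj h'; omega
      omega
    rcases (hQ.rel _ _).1 hxy with h' | h' | h'
    · exact hint s hs' _ _ h'
    · rw [hint s hs' _ _ h'.1, hint s hs' _ _ h'.2, hab]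
    · rw [hint s hs' _ _ h'.1, hint s hs' _ _ h'.2, hab]

theorem exists_flag_of_isTreeLabeling (hn : 1 ≤ n) (h : IsTreeLabeling a b) :
    ∃ C : Flag (NCP n), HasStepLabels C a b := by
  have hnext : ∀ i (P : NCP n), Compatible a b i P → ∃ Q, Compatible a b (i + 1) Q ∧
      ∀ hi : i < n - 1, Step P Q (a ⟨i, hi⟩) (b ⟨i, hi⟩) := by
    intro i P hP
    by_cases hi : i < n - 1
    · obtain ⟨Q, hQ, hQ'⟩ := Compatible.exists_step h (i := ⟨i, hi⟩) hP
      exact ⟨Q, hQ', fun _ => hQ⟩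
    -- From the index `n - 1` on there are no labels left, so the partition can stay the same.
    · refine ⟨P, ⟨fun x => ?_, fun s hs => ?_⟩, fun h => (hi h).elim⟩
      · rw [hP.1]
        refine exists_congr fun t => and_congr_left fun _ => ?_
        omega
      · omega
  choose f hf hf' using hnext
  obtain ⟨P, -, hP⟩ := exists_bot n
  have h0 : Compatible a b 0 P := by
    refine ⟨fun x => ⟨?_, ?_⟩, fun s _ x y hxy => by rw [hP _ _ hxy]⟩
    · rintro ⟨y, hy, h⟩
      exact absurd (hP _ _ h) hy.ne
    · rintro ⟨t, ht, -⟩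
      omega
  let x : (i : ℕ) → {P : NCP n // Compatible a b i P} := fun i =>
    Nat.rec ⟨P, h0⟩ (fun i p => ⟨f i p.1 p.2, hf i p.1 p.2⟩) i
  exact exists_flag_of_steps hn (x := fun i => (x i).1) fun i => hf' i (x i).1 (x i).2 i.2

end NCP

/-! ### Parking functions and tree labelings -/

theorem isParkingFunction_iff {m : ℕ} (a : Fin m → ℕ) :
    IsParkingFunction a ↔ (∀ j, 1 ≤ a j) ∧
      ∀ k ≤ m, k ≤ (Finset.univ.filter fun t => a t ≤ k).card := by
  have hmono := Tuple.monotone_sort a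
  constructor
  · rintro ⟨h1, h2⟩
    refine ⟨fun j => (h1 j).1, fun k hk => ?_⟩
    have hsub : (Finset.univ.filter fun j : Fin m => (j : ℕ) < k).map
        (Tuple.sort a).toEmbedding ⊆ Finset.univ.filter fun t => a t ≤ k := by
      intro t ht
      obtain ⟨j, hj, rfl⟩ := Finset.mem_map.1 ht
      have := h2 j
      simp only [Finset.mem_filter, Finset.mem_univ, true_and] at hj ⊢
      exact this.trans hj
    have := Finset.card_le_card hsub
    rwa [Finset.card_map, Fin.card_filter_val_lt, min_eq_right hk] at this
  · rintro ⟨h1, h2⟩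
    have h3 : ∀ j : Fin m, a (Tuple.sort a j) ≤ j + 1 := by
      intro j
      by_contra! hcon
      -- If the sorted value at position `j` exceeds `j + 1`, then all values up to `j + 1` sit at
      -- the `j` positions before it.
      have hsub : (Finset.univ.filter fun t => a t ≤ j + 1) ⊆
          (Finset.univ.filter fun i : Fin m => (i : ℕ) < j).map (Tuple.sort a).toEmbedding := by
        intro t ht
        simp only [Finset.mem_filter, Finset.mem_univ, true_and] at ht
        refine Finset.mem_map.2 ⟨(Tuple.sort a).symm t, ?_, by simp⟩
        simp only [Finset.mem_filter, Finset.mem_univ, true_and]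
        by_contra! hle
        have := hmono (show j ≤ (Tuple.sort a).symm t from hle)
        simp only [Function.comp_apply, Equiv.apply_symm_apply] at this
        omega
      have := Finset.card_le_card hsub
      rw [Finset.card_map, Fin.card_filter_val_lt] at this
      have := h2 (j + 1) (by omega)
      omega
    refine ⟨fun j => ⟨h1 j, ?_⟩, h3⟩
    have := h3 ((Tuple.sort a).symm j)
    rw [Equiv.apply_symm_apply] at this
    omega

namespace IsTreeLabeling

variable {m : ℕ} {a b b' : Fin m → ℕ}

theorem image_eq (h : IsTreeLabeling a b) :
    Finset.univ.image b = Finset.Icc 2 (m + 1) := by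
  refine Finset.eq_of_subset_of_card_le (fun x hx => ?_) ?_
  · obtain ⟨t, -, rfl⟩ := Finset.mem_image.1 hx
    have := h.pos t
    have := h.lt t
    exact Finset.mem_Icc.2 ⟨by omega, h.le t⟩
  · rw [Finset.card_image_of_injective _ h.inj, Nat.card_Icc, Finset.card_univ, Fintype.card_fin]
    omega

theorem exists_eq (h : IsTreeLabeling a b) {p : ℕ} (hp : 2 ≤ p) (hp' : p ≤ m + 1) :
    ∃ t, b t = p := by
  have : p ∈ Finset.univ.image b := h.image_eq ▸ Finset.mem_Icc.2 ⟨hp, hp'⟩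
  simpa using this

/-- Each of the `k` values `2, …, k + 1` is some `b t`, and then `a t < b t` gives `a t ≤ k`. -/
theorem isParkingFunction (h : IsTreeLabeling a b) : IsParkingFunction a := by
  refine (isParkingFunction_iff a).2 ⟨h.pos, fun k hk => ?_⟩
  have hsub : Finset.Icc 2 (k + 1) ⊆ (Finset.univ.filter fun t => a t ≤ k).image b := by
    intro p hp
    rw [Finset.mem_Icc] at hp
    obtain ⟨t, rfl⟩ := h.exists_eq hp.1 (by omega)
    have := h.lt t
    exact Finset.mem_image_of_mem _ (by simp only [Finset.mem_filter, Finset.mem_univ, true_and]; omega)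
  have h1 := (Finset.card_le_card hsub).trans Finset.card_image_le
  rw [Nat.card_Icc] at h1
  omega

/-- Induction on the value `p`. If `p` went to `t` in one labeling and to `s ≠ t` in the other, then
each of `s`, `t` would get a value above `p` where it does not get `p`. The two instances of `order`
then place `(a s, s)` and `(a t, t)` strictly below one another. -/
theorem unique (h : IsTreeLabeling a b) (h' : IsTreeLabeling a b') : b = b' := by
  have key : ∀ p t, b t = p ↔ b' t = p := by
    intro p
    induction p using Nat.strong_induction_on with
    | _ p ih =>
    have aux : ∀ {c c' : Fin m → ℕ}, IsTreeLabeling a c → IsTreeLabeling a c' →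
        (∀ q < p, ∀ t, c t = q ↔ c' t = q) → ∀ t, c t = p → c' t = p := by
      intro c c' hc hc' ih t ht
      have h2 : 2 ≤ p := by have := hc.pos t; have := hc.lt t; omega
      obtain ⟨s, hs⟩ := hc'.exists_eq h2 (by have := hc.le t; omega)
      by_cases hst : s = t
      · rw [← hst]; exact hs
      have h3 : p < c' t := by
        by_contra! hcon
        rcases hcon.eq_or_lt with heq | hlt
        · exact hst (hc'.inj (hs.trans heq.symm))
        · exact hlt.ne' (by rw [← ht]; exact (ih _ hlt t).2 rfl)
      have h4 : p < c s := by
        by_contra! hcon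
        rcases hcon.eq_or_lt with heq | hlt
        · exact hst (hc.inj (heq.trans ht.symm))
        · exact hlt.ne' (by rw [← hs]; exact (ih _ hlt s).1 rfl)
      have h5 := hc.order s t (by omega) (by have := hc'.lt s; omega)
      have h6 := hc'.order t s (by omega) (by have := hc.lt t; omega)
      omega
    exact fun t => ⟨aux h h' ih t, aux h' h (fun q hq t => (ih q hq t).symm) t⟩
  exact funext fun t => ((key _ t).1 rfl).symm

end IsTreeLabeling

/-- The values are handed out greedily in increasing order; `U` is the set of indices served so far,
and indices outside `U` count as having larger values in the order condition. -/
theorem IsParkingFunction.exists_isTreeLabeling {m : ℕ} {a : Fin m → ℕ}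
    (ha : IsParkingFunction a) : ∃ b, IsTreeLabeling a b := by
  obtain ⟨hpos, hcard⟩ := (isParkingFunction_iff a).1 ha
  have key : ∀ k ≤ m, ∃ (b : Fin m → ℕ) (U : Finset (Fin m)), U.card = k ∧
      (∀ t ∈ U, a t < b t ∧ b t ≤ k + 1) ∧ (∀ s ∈ U, ∀ t ∈ U, b s = b t → s = t) ∧
      ∀ t ∈ U, ∀ s, (s ∈ U → b t < b s) → a s < b t → s ≠ t →
        a s < a t ∨ (a s = a t ∧ s < t) := by
    intro k
    induction k with
    | zero => exact fun _ => ⟨fun _ => 0, ∅, by simp⟩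
    | succ k ih =>
      intro hk
      obtain ⟨b, U, hU, hlt, hinj, hord⟩ := ih (by omega)
      -- At least `k + 1` indices have `a t ≤ k + 1`, and only `k` are used. The next value is `k +
      -- 2`.
      have hne : (Finset.univ.filter (fun t => a t ≤ k + 1) \ U).Nonempty := by
        rw [← Finset.card_pos]
        have := Finset.le_card_sdiff U (Finset.univ.filter fun t => a t ≤ k + 1)
        have := hcard (k + 1) hk
        omega
      obtain ⟨t, ht, hmax⟩ := Finset.exists_max_image _ (fun t => toLex (a t, t)) hne
      simp only [Finset.mem_sdiff, Finset.mem_filter, Finset.mem_univ, true_and] at ht hmax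
      have hu : ∀ s ∈ U, Function.update b t (k + 2) s = b s := fun s hs =>
        Function.update_of_ne (fun hst => ht.2 (by rwa [← hst])) _ _
      refine ⟨Function.update b t (k + 2), insert t U, ?_, ?_, ?_, ?_⟩
      · rw [Finset.card_insert_of_notMem ht.2, hU]
      · intro s hs
        rcases Finset.mem_insert.1 hs with rfl | hs
        · rw [Function.update_self]
          omega
        · rw [hu s hs]
          have := hlt s hs
          omega
      · intro s hs s' hs' heq
        rcases Finset.mem_insert.1 hs with h | hs <;>
          rcases Finset.mem_insert.1 hs' with h' | hs'
        · rw [h, h']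
        · rw [h, Function.update_self, hu s' hs'] at heq
          have := hlt s' hs'
          omega
        · rw [h', Function.update_self, hu s hs] at heq
          have := hlt s hs
          omega
        · rw [hu s hs, hu s' hs'] at heq
          exact hinj s hs s' hs' heq
      · intro s hs s' h1 h2 hne
        rcases Finset.mem_insert.1 hs with rfl | hs
        · rw [Function.update_self] at h1 h2
          have hs' : s' ∉ U := fun h => by
            have h3 := h1 (Finset.mem_insert_of_mem h)
            rw [hu s' h] at h3
            have := hlt s' h
            omega
          have h3 := hmax s' ⟨by omega, hs'⟩
          rw [Prod.Lex.toLex_le_toLex] at h3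
          rcases h3 with h3 | h3
          · exact .inl h3
          · exact .inr ⟨h3.1, lt_of_le_of_ne h3.2 hne⟩
        · rw [hu s hs] at h1 h2
          refine hord s hs s' (fun h => ?_) h2 hne
          have h3 := h1 (Finset.mem_insert_of_mem h)
          rwa [hu s' h] at h3
  obtain ⟨b, U, hU, hlt, hinj, hord⟩ := key m le_rfl
  obtain rfl : U = Finset.univ := by rw [← Finset.card_eq_iff_eq_univ, hU, Fintype.card_fin]
  refine ⟨b, fun s t h => hinj s (Finset.mem_univ _) t (Finset.mem_univ _) h, hpos,
    fun t => (hlt t (Finset.mem_univ _)).1, fun t => (hlt t (Finset.mem_univ _)).2,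
    fun s t h1 h2 => hord t (Finset.mem_univ _) s (fun _ => h1) h2 ?_⟩
  rintro rfl
  omega

namespace NCP

/-- Stanley's bijection between the maximal chains of non-crossing partitions and the parking
functions. -/
theorem exists_flag_equiv {n : ℕ} (hn : 1 ≤ n) :
    ∃ (Φ : Flag (NCP n) ≃ {a : Fin (n - 1) → ℕ // IsParkingFunction a})
      (β : Flag (NCP n) → Fin (n - 1) → ℕ),
      ∀ (C : Flag (NCP n)) (a b : Fin (n - 1) → ℕ),
        HasStepLabels C a b ↔ a = (Φ C).1 ∧ b = β C := by
  choose α β h using exists_hasStepLabels hn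
  let Φ : Flag (NCP n) → {a : Fin (n - 1) → ℕ // IsParkingFunction a} := fun C =>
    ⟨α C, ((h C).isTreeLabeling hn).isParkingFunction⟩
  -- Injectivity: `a` determines `b`, and the two together determine the chain. Surjectivity:
  -- complete `a` greedily, then run the merges.
  have hΦ : Function.Bijective Φ := by
    constructor
    · intro C C' heq
      have h1 := h C
      have h2 := h C'
      rw [← show α C = α C' from congrArg Subtype.val heq] at h2
      rw [← (h1.isTreeLabeling hn).unique (h2.isTreeLabeling hn)] at h2
      exact h1.flag_unique hn h2
    · rintro ⟨a, ha⟩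
      obtain ⟨b, hb⟩ := ha.exists_isTreeLabeling
      obtain ⟨C, hC⟩ := exists_flag_of_isTreeLabeling hn hb
      exact ⟨C, Subtype.ext ((h C).unique hn hC).1⟩
  refine ⟨Equiv.ofBijective Φ hΦ, β, fun C a b => ⟨fun hab => hab.unique hn (h C), ?_⟩⟩
  rintro ⟨rfl, rfl⟩
  exact h C

end NCP

/-! ### Counting parking functions on a circle -/

section ParkingCount

variable {m : ℕ}

/-- Parking functions with values in `ZMod (m + 1)`, shifted by one. -/
def IsParked (f : Fin m → ZMod (m + 1)) : Prop :=
  ∀ k ≤ m, k ≤ (Finset.univ.filter fun t => (f t).val < k).card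

/-- The surplus of cars over spots among the first `k` spots of the unrolled circle. -/
def surplus (f : Fin m → ZMod (m + 1)) (k : ℕ) : ℤ :=
  ∑ j ∈ Finset.range k, (((Finset.univ.filter fun t => f t = (j : ZMod (m + 1))).card : ℤ) - 1)

theorem card_val_sub_lt (f : Fin m → ZMod (m + 1)) (r k : ℕ) (hk : k ≤ m + 1) :
    (Finset.univ.filter fun t => (f t - (r : ZMod (m + 1))).val < k).card =
      ∑ j ∈ Finset.range k,
        (Finset.univ.filter fun t => f t = ((r + j : ℕ) : ZMod (m + 1))).card := by
  rw [Finset.card_eq_sum_card_fiberwise (f := fun t => (f t - (r : ZMod (m + 1))).val)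
    (t := Finset.range k) (fun t ht => by simpa using ht)]
  refine Finset.sum_congr rfl fun j hj => congrArg Finset.card ?_
  rw [Finset.mem_range] at hj
  ext t
  simp only [Finset.mem_filter, Finset.mem_univ, true_and]
  constructor
  · rintro ⟨-, h⟩
    have := ZMod.natCast_zmod_val (f t - (r : ZMod (m + 1)))
    rw [h] at this
    push_cast
    rw [this]
    ring
  · intro h
    have : (f t - (r : ZMod (m + 1))).val = j := by
      rw [h]
      push_cast
      rw [add_sub_cancel_left, ZMod.val_natCast_of_lt (by omega)]
    exact ⟨by omega, this⟩

theorem surplus_add (f : Fin m → ZMod (m + 1)) (r k : ℕ) (hk : k ≤ m + 1) :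
    surplus f (r + k) = surplus f r +
      ((Finset.univ.filter fun t => (f t - (r : ZMod (m + 1))).val < k).card : ℤ) - k := by
  rw [card_val_sub_lt f r k hk, surplus, Finset.sum_range_add, ← surplus, Finset.sum_sub_distrib]
  simp
  ring

/-- One full turn meets all `m` cars but `m + 1` spots. -/
theorem surplus_add_period (f : Fin m → ZMod (m + 1)) (r : ℕ) :
    surplus f (r + (m + 1)) = surplus f r - 1 := by
  rw [surplus_add f r (m + 1) le_rfl, Finset.filter_true_of_mem fun t _ => ZMod.val_lt _]
  simp
  ring

/-- Shifting by `r` makes `r` the first spot, and the parking inequalities say that the surplus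
never drops below its value at `r` within the next `m` spots. The good shift is therefore the first
minimum of the surplus. -/
theorem isParked_sub_iff (f : Fin m → ZMod (m + 1)) (r : ℕ) :
    IsParked (fun t => f t - (r : ZMod (m + 1))) ↔ ∀ k ≤ m, surplus f r ≤ surplus f (r + k) := by
  refine forall₂_congr fun k hk => ?_
  rw [surplus_add f r k (by omega)]
  beta_reduce
  omega

/-- Exactly one rotation of a function on the circle parks. -/
theorem existsUnique_isParked_sub (f : Fin m → ZMod (m + 1)) :
    ∃! c : ZMod (m + 1), IsParked fun t => f t - c := by
  classical
  have hex : ∃ r, r ≤ m ∧ ∀ j ≤ m, surplus f r ≤ surplus f j := by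
    obtain ⟨r, hr, h⟩ := Finset.exists_min_image (Finset.range (m + 1)) (surplus f) ⟨0, by simp⟩
    simp only [Finset.mem_range, Nat.lt_succ_iff] at hr h
    exact ⟨r, hr, h⟩
  obtain ⟨hr, hmin⟩ := Nat.find_spec hex
  have hfirst : ∀ j < Nat.find hex, surplus f (Nat.find hex) < surplus f j := by
    intro j hj
    have h1 := Nat.find_min hex hj
    push Not at h1
    obtain ⟨i, hi, h2⟩ := h1 (by omega)
    exact (hmin i hi).trans_lt h2
  generalize Nat.find hex = r at hr hmin hfirst
  have hpark : IsParked fun t => f t - (r : ZMod (m + 1)) := by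
    rw [isParked_sub_iff]
    intro k hk
    by_cases h : r + k ≤ m
    · exact hmin _ h
    -- Past the end of the turn the surplus drops by one. This is harmless because it was strictly
    -- larger before the first minimum.
    · have h1 := surplus_add_period f (r + k - (m + 1))
      rw [Nat.sub_add_cancel (by omega)] at h1
      have := hfirst (r + k - (m + 1)) (by omega)
      omega
  have aux : ∀ r r', r < r' → r' ≤ m → IsParked (fun t => f t - (r : ZMod (m + 1))) →
      ¬ IsParked (fun t => f t - (r' : ZMod (m + 1))) := by
    intro r r' h1 h2 h3 h4
    rw [isParked_sub_iff] at h3 h4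
    have h5 := h3 (r' - r) (by omega)
    have h6 := h4 (r + (m + 1) - r') (by omega)
    rw [Nat.add_sub_cancel' (by omega)] at h5 h6
    rw [surplus_add_period] at h6
    omega
  refine ⟨r, hpark, fun c hc => ?_⟩
  have hcv := ZMod.natCast_zmod_val c
  have hlt := ZMod.val_lt c
  rw [← hcv] at hc
  rcases lt_trichotomy r c.val with h | h | h
  · exact (aux r c.val h (by omega) hpark hc).elim
  · rw [h, hcv]
  · exact (aux c.val r h hr hc hpark).elim

theorem card_isParked_mul (m : ℕ) :
    Nat.card {f : Fin m → ZMod (m + 1) // IsParked f} * (m + 1) = (m + 1) ^ m := by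
  have e : {f : Fin m → ZMod (m + 1) // IsParked f} × ZMod (m + 1) ≃ (Fin m → ZMod (m + 1)) := by
    refine Equiv.ofBijective (fun p t => p.1.1 t + p.2) ⟨?_, fun f => ?_⟩
    · rintro ⟨⟨f, hf⟩, c⟩ ⟨⟨g, hg⟩, d⟩ h
      have h' : ∀ t, f t + c = g t + d := fun t => congrFun h t
      have hcd : c = d := (existsUnique_isParked_sub fun t => f t + c).unique
        (by simpa using hf) (by simpa [h'] using hg)
      subst hcd
      simpa [funext_iff] using h'
    · obtain ⟨c, hc, -⟩ := existsUnique_isParked_sub f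
      exact ⟨⟨⟨_, hc⟩, c⟩, by simp⟩
  have := Nat.card_congr e
  simpa [Nat.card_prod] using this

/-- There are `(m + 1) ^ (m - 1)` parking functions of length `m`. -/
theorem card_isParkingFunction (m : ℕ) :
    Nat.card {a : Fin m → ℕ // IsParkingFunction a} = (m + 1) ^ (m - 1) := by
  have e : {a : Fin m → ℕ // IsParkingFunction a} ≃ {f : Fin m → ZMod (m + 1) // IsParked f} := by
    have hval : ∀ a : Fin m → ℕ, IsParkingFunction a → ∀ t,
        ((a t - 1 : ℕ) : ZMod (m + 1)).val = a t - 1 := fun a ha t =>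
      ZMod.val_natCast_of_lt (by have := ha.1 t; omega)
    refine ⟨fun a => ⟨fun t => ((a.1 t - 1 : ℕ) : ZMod (m + 1)), fun k hk => ?_⟩,
      fun f => ⟨fun t => (f.1 t).val + 1, ?_⟩, fun a => ?_, fun f => ?_⟩
    · simp only [hval a.1 a.2]
      refine (((isParkingFunction_iff _).1 a.2).2 k hk).trans (Finset.card_le_card ?_)
      intro t
      have := a.2.1 t
      simp only [Finset.mem_filter, Finset.mem_univ, true_and]
      omega
    · rw [isParkingFunction_iff]
      exact ⟨fun t => by omega, f.2⟩
    · refine Subtype.ext (funext fun t => ?_)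
      have := a.2.1 t
      simp only [hval a.1 a.2]
      omega
    · refine Subtype.ext (funext fun t => ?_)
      simp
  rw [Nat.card_congr e]
  have h := card_isParked_mul m
  -- For `m = 0` the exponent `m - 1` is truncated to `0`, and there is one empty function.
  rcases m with - | m
  · simpa using h
  · rw [pow_succ] at h
    exact Nat.eq_of_mul_eq_mul_right (by omega) h

end ParkingCount

/-! ### Labeled trees and their right chains -/

namespace LabeledTree

open BinaryTree

variable {T T' s t l r l' r' : BinaryTree ℕ} {a b c x y z w : ℕ}

theorem mem_inorder_node : x ∈ inorder (node a l r) ↔ x = a ∨ x ∈ inorder l ∨ x ∈ inorder r := by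
  simp only [inorder, List.mem_append, List.mem_cons]
  tauto

theorem nodup_inorder_node : (inorder (node a l r)).Nodup ↔
    a ∉ inorder l ∧ a ∉ inorder r ∧ (∀ x ∈ inorder l, x ∉ inorder r) ∧
      (inorder l).Nodup ∧ (inorder r).Nodup := by
  simp only [inorder, List.nodup_append, List.nodup_cons, List.mem_cons]
  grind

theorem isSubtree_refl (T : BinaryTree ℕ) : IsSubtree T T := by
  cases T <;> simp [IsSubtree]

theorem IsSubtree.mem (h : IsSubtree s T) (hx : x ∈ inorder s) : x ∈ inorder T := by
  induction T with
  | nil => obtain rfl : s = nil := h; exact hx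
  | node a l r ihl ihr =>
    rw [mem_inorder_node]
    rcases h with rfl | h | h
    · rwa [mem_inorder_node] at hx
    · exact .inr (.inl (ihl h))
    · exact .inr (.inr (ihr h))

theorem IsSubtree.trans (h : IsSubtree s t) (h' : IsSubtree t T) : IsSubtree s T := by
  induction T with
  | nil => obtain rfl : t = nil := h'; exact h
  | node a l r ihl ihr =>
    rcases h' with rfl | h' | h'
    · exact h
    · exact .inr (.inl (ihl h'))
    · exact .inr (.inr (ihr h'))

theorem isSubtree_left : IsSubtree l (node a l r) := .inr (.inl (isSubtree_refl l))

theorem isSubtree_right : IsSubtree r (node a l r) := .inr (.inr (isSubtree_refl r))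

theorem mem_root : a ∈ inorder (node a l r) := mem_inorder_node.2 (.inl rfl)

theorem mem_left (h : x ∈ inorder l) : x ∈ inorder (node a l r) :=
  mem_inorder_node.2 (.inr (.inl h))

theorem mem_right (h : x ∈ inorder r) : x ∈ inorder (node a l r) :=
  mem_inorder_node.2 (.inr (.inr h))

theorem IsSubtree.unique (hT : (inorder T).Nodup) (h : IsSubtree (node c l r) T)
    (h' : IsSubtree (node c l' r') T) : l = l' ∧ r = r' := by
  induction T with
  | nil => cases h
  | node a L R ihL ihR =>
    obtain ⟨h1, h2, h3, h4, h5⟩ := nodup_inorder_node.1 hT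
    have m1 : ∀ {l r}, IsSubtree (node c l r) L → c ∈ inorder L := fun h => h.mem mem_root
    have m2 : ∀ {l r}, IsSubtree (node c l r) R → c ∈ inorder R := fun h => h.mem mem_root
    rcases h with h | h | h <;> rcases h' with h' | h' | h'
    · cases h; cases h'; exact ⟨rfl, rfl⟩
    · cases h; exact (h1 (m1 h')).elim
    · cases h; exact (h2 (m2 h')).elim
    · cases h'; exact (h1 (m1 h)).elim
    · exact ihL h4 h h'
    · exact (h3 _ (m1 h) (m2 h')).elim
    · cases h'; exact (h2 (m2 h)).elim
    · exact (h3 _ (m1 h') (m2 h)).elim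
    · exact ihR h5 h h'

/-- If `b` is in the left subtree of a node and `b` is the left child of another one, then these
nodes agree or the second one belongs to the left subtree of the first. -/
theorem IsSubtree.eq_or_left {U V W : BinaryTree ℕ} (hT : (inorder T).Nodup)
    (ht : IsSubtree (node a l r) T) (hb : b ∈ inorder l)
    (hs : IsSubtree (node c (node b U V) W) T) :
    node c (node b U V) W = node a l r ∨ IsSubtree (node c (node b U V) W) l := by
  induction T with
  | nil => cases ht
  | node e L R ihL ihR =>
    obtain ⟨h1, h2, h3, h4, h5⟩ := nodup_inorder_node.1 hT
    have hbs : b ∈ inorder (node c (node b U V) W) := mem_left mem_root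
    have hbt : b ∈ inorder (node a l r) := mem_left hb
    rcases ht with ht | ht | ht <;> rcases hs with hs | hs | hs
    · exact .inl (hs.trans ht.symm)
    · cases ht; exact .inr hs
    · cases ht; exact (h3 _ hb (hs.mem hbs)).elim
    · cases hs
      obtain ⟨h6, h7, -, -, -⟩ := nodup_inorder_node.1 h4
      rcases ht with ht | ht | ht
      · cases ht; exact (h6 hb).elim
      · exact (h6 (ht.mem hbt)).elim
      · exact (h7 (ht.mem hbt)).elim
    · exact ihL h4 ht hs
    · exact (h3 _ (ht.mem hbt) (hs.mem hbs)).elim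
    · cases hs; exact (h3 _ mem_root (ht.mem hbt)).elim
    · exact (h3 _ (hs.mem hbs) (ht.mem hbt)).elim
    · exact ihR h5 ht hs

/-! ### Right chains -/

/-- The labels of the right-extended sequence of the root. -/
def rightLabels : BinaryTree ℕ → Multiset ℕ
  | nil => 0
  | node a _ r => a ::ₘ rightLabels r

/-- The right-extended sequence of the root as the only element, nothing for the empty tree. -/
def rootChain : BinaryTree ℕ → Multiset (Multiset ℕ)
  | nil => 0
  | node a l r => {rightLabels (node a l r)}

/-- The maximal right-extended sequences that do not start at the root. -/
def lowerChains : BinaryTree ℕ → Multiset (Multiset ℕ)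
  | nil => 0
  | node _ l r => rootChain l + lowerChains l + lowerChains r

/-- The maximal right-extended sequences of a tree. -/
def chains (T : BinaryTree ℕ) : Multiset (Multiset ℕ) := rootChain T + lowerChains T

/-- The nodes `x` and `y` lie on the same maximal path of right edges. -/
def Rel (T : BinaryTree ℕ) (x y : ℕ) : Prop := ∃ α ∈ chains T, x ∈ α ∧ y ∈ α

theorem chains_of_ne_nil (h : T ≠ nil) : chains T = rightLabels T ::ₘ lowerChains T := by
  cases T with
  | nil => exact (h rfl).elim
  | node a l r => exact Multiset.singleton_add _ _

theorem lowerChains_node : lowerChains (node a l r) = chains l + lowerChains r := rfl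

theorem chains_node : chains (node a l r) = (a ::ₘ rightLabels r) ::ₘ (chains l + lowerChains r) :=
  Multiset.singleton_add _ _

theorem join_chains_aux (T : BinaryTree ℕ) :
    rightLabels T + (lowerChains T).join = (inorder T : Multiset ℕ) ∧
      (chains T).join = (inorder T : Multiset ℕ) := by
  induction T with
  | nil => simp [rightLabels, lowerChains, chains, rootChain, inorder]
  | node a l r ihl ihr =>
    have h : rightLabels (node a l r) + (lowerChains (node a l r)).join =
        (inorder (node a l r) : Multiset ℕ) := by
      rw [lowerChains_node, Multiset.join_add, ihl.2, rightLabels, inorder, ← Multiset.coe_add,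
        ← Multiset.cons_coe, ← ihr.1, Multiset.cons_add, Multiset.add_cons]
      congr 1
      rw [← add_assoc, ← add_assoc, add_comm (rightLabels r)]
    refine ⟨h, ?_⟩
    rw [chains_of_ne_nil (by simp), Multiset.join_cons, h]

theorem join_chains (T : BinaryTree ℕ) : (chains T).join = (inorder T : Multiset ℕ) :=
  (join_chains_aux T).2

/-- The chains together list the in-order word, so with distinct labels they are disjoint. -/
theorem chains_unique (hT : (inorder T).Nodup) {α β : Multiset ℕ} (hα : α ∈ chains T)
    (hβ : β ∈ chains T) (hxα : x ∈ α) (hxβ : x ∈ β) : α = β := by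
  obtain ⟨Z, hZ⟩ := Multiset.exists_cons_of_mem hα
  rw [hZ, Multiset.mem_cons] at hβ
  rcases hβ with hβ | hβ
  · exact hβ.symm
  · exfalso
    have h := join_chains T
    rw [hZ, Multiset.join_cons] at h
    have h1 : (α + Z.join).Nodup := by rw [h]; exact hT
    exact Multiset.disjoint_left.1 (Multiset.nodup_add.1 h1).2.2 hxα
      (Multiset.mem_join.2 ⟨β, hβ, hxβ⟩)

theorem Rel.symm (h : Rel T x y) : Rel T y x := by
  obtain ⟨α, hα, hx, hy⟩ := h
  exact ⟨α, hα, hy, hx⟩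

theorem Rel.trans (hT : (inorder T).Nodup) (h : Rel T x y) (h' : Rel T y z) : Rel T x z := by
  obtain ⟨α, hα, hx, hy⟩ := h
  obtain ⟨β, hβ, hy', hz⟩ := h'
  obtain rfl := chains_unique hT hα hβ hy hy'
  exact ⟨α, hα, hx, hz⟩

theorem rel_self_iff : Rel T x x ↔ x ∈ inorder T := by
  rw [← Multiset.mem_coe, ← join_chains, Multiset.mem_join]
  simp [Rel]

theorem Rel.mem_left (h : Rel T x y) : x ∈ inorder T := by
  obtain ⟨α, hα, hx, -⟩ := h
  exact rel_self_iff.1 ⟨α, hα, hx, hx⟩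

theorem Rel.mem_right (h : Rel T x y) : y ∈ inorder T := h.symm.mem_left

theorem mem_of_mem_rightLabels (h : x ∈ rightLabels T) : x ∈ inorder T := by
  have h' := (join_chains_aux T).1
  rw [← Multiset.mem_coe, ← h', Multiset.mem_add]
  exact .inl h

theorem rel_root (hT : (inorder (node a l r)).Nodup) :
    Rel (node a l r) a x ↔ x = a ∨ x ∈ rightLabels r := by
  have h : (a ::ₘ rightLabels r) ∈ chains (node a l r) := by
    rw [chains_node]; exact Multiset.mem_cons_self _ _
  constructor
  · rintro ⟨α, hα, ha, hx⟩
    rw [chains_unique hT hα h ha (Multiset.mem_cons_self _ _)] at hx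
    exact Multiset.mem_cons.1 hx
  · intro hx
    exact ⟨_, h, Multiset.mem_cons_self _ _, Multiset.mem_cons.2 hx⟩

theorem rel_node : Rel (node a l r) x y ↔
    (x = a ∧ (y = a ∨ y ∈ rightLabels r)) ∨ (y = a ∧ x ∈ rightLabels r) ∨
      Rel l x y ∨ Rel r x y := by
  have h1 : Rel (node a l r) x y ↔ ((x ∈ a ::ₘ rightLabels r) ∧ y ∈ a ::ₘ rightLabels r) ∨
      Rel l x y ∨ ∃ α ∈ lowerChains r, x ∈ α ∧ y ∈ α := by
    simp only [Rel, chains_node, Multiset.mem_cons, Multiset.mem_add, or_and_right, exists_or,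
      exists_eq_left]
  have h2 : Rel r x y ↔ (x ∈ rightLabels r ∧ y ∈ rightLabels r) ∨
      ∃ α ∈ lowerChains r, x ∈ α ∧ y ∈ α := by
    cases r with
    | nil => simp [Rel, chains, rootChain, lowerChains, rightLabels]
    | node b l' r' =>
      simp only [Rel, chains_of_ne_nil (T := node b l' r') (by simp), Multiset.mem_cons,
        or_and_right, exists_or, exists_eq_left]
  rw [h1, h2, Multiset.mem_cons, Multiset.mem_cons]
  clear h1 h2
  generalize Rel l x y = p₁
  generalize (∃ α ∈ lowerChains r, x ∈ α ∧ y ∈ α) = p₂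
  generalize (x = a) = p₃
  generalize (y = a) = p₄
  tauto

/-! ### Spines -/

theorem ofLeftSpine_leftSpine (t : BinaryTree ℕ) : ofLeftSpine (leftSpine t) = t := by
  induction t with
  | nil => rfl
  | node a l r ihl _ => simp [leftSpine, ofLeftSpine, ihl]

theorem ofRightSpine_rightSpine (t : BinaryTree ℕ) : ofRightSpine (rightSpine t) = t := by
  induction t with
  | nil => rfl
  | node a l r _ ihr => simp [rightSpine, ofRightSpine, ihr]

theorem rightSpine_ofRightSpine (ps : List (ℕ × BinaryTree ℕ)) :
    rightSpine (ofRightSpine ps) = ps := by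
  induction ps with
  | nil => rfl
  | cons p ps ih => simp [rightSpine, ofRightSpine, ih]

/-- Every node on a path of left edges starts its own right chain. The result is a sum over the
path, so distributing the path between `T₁` and `T₂` distributes the chains. -/
theorem chains_ofLeftSpine (ps : List (ℕ × BinaryTree ℕ)) : chains (ofLeftSpine ps) =
    (ps.map fun p => (p.1 ::ₘ rightLabels p.2) ::ₘ lowerChains p.2).sum := by
  induction ps with
  | nil => rfl
  | cons p ps ih =>
    rw [ofLeftSpine, chains_node, ih, List.map_cons, List.sum_cons, Multiset.cons_add,
      add_comm (lowerChains p.2)]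

theorem rightLabels_eq (t : BinaryTree ℕ) :
    rightLabels t = (((rightSpine t).map Prod.fst : List ℕ) : Multiset ℕ) := by
  induction t with
  | nil => rfl
  | node a l r _ ih => simp [rightSpine, rightLabels, ih]

theorem lowerChains_eq (t : BinaryTree ℕ) :
    lowerChains t = ((rightSpine t).map fun p => chains p.2).sum := by
  induction t with
  | nil => rfl
  | node a l r _ ih => simp [rightSpine, lowerChains_node, ih]

theorem rightLabels_mergeRight (s t : BinaryTree ℕ) :
    rightLabels (mergeRight s t) = rightLabels s + rightLabels t := by
  rw [rightLabels_eq, rightLabels_eq, rightLabels_eq, mergeRight, rightSpine_ofRightSpine,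
    Multiset.coe_add, ← List.map_append, Multiset.coe_eq_coe]
  exact (List.merge_perm_append ..).map _

theorem lowerChains_mergeRight (s t : BinaryTree ℕ) :
    lowerChains (mergeRight s t) = lowerChains s + lowerChains t := by
  rw [lowerChains_eq, lowerChains_eq, lowerChains_eq, mergeRight, rightSpine_ofRightSpine,
    ← List.sum_append, ← List.map_append]
  exact ((List.merge_perm_append ..).map _).sum_eq

/-! ### Contexts -/

/-- A tree with a hole in the place of one subtree. -/
inductive Ctx where
  | hole : Ctx
  | left (a : ℕ) (K : Ctx) (r : BinaryTree ℕ) : Ctx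
  | right (a : ℕ) (l : BinaryTree ℕ) (K : Ctx) : Ctx

namespace Ctx

/-- Fill the hole. -/
def plug : Ctx → BinaryTree ℕ → BinaryTree ℕ
  | hole, t => t
  | left a K r, t => node a (K.plug t) r
  | right a l K, t => node a l (K.plug t)

/-- The word before the hole. -/
def before : Ctx → List ℕ
  | hole => []
  | left _ K _ => K.before
  | right a l K => inorder l ++ a :: K.before

/-- The word after the hole. -/
def after : Ctx → List ℕ
  | hole => []
  | left a K r => K.after ++ a :: inorder r
  | right _ _ K => K.after

/-- Composition of contexts. -/
def comp : Ctx → Ctx → Ctx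
  | hole, K' => K'
  | left a K r, K' => left a (K.comp K') r
  | right a l K, K' => right a l (K.comp K')

theorem plug_comp (K K' : Ctx) (t : BinaryTree ℕ) : (K.comp K').plug t = K.plug (K'.plug t) := by
  induction K with
  | hole => rfl
  | left a K r ih => simp [comp, plug, ih]
  | right a l K ih => simp [comp, plug, ih]

theorem inorder_plug (K : Ctx) (t : BinaryTree ℕ) :
    inorder (K.plug t) = K.before ++ inorder t ++ K.after := by
  induction K with
  | hole => simp [plug, before, after]
  | left a K r ih => simp [plug, before, after, ih, inorder]
  | right a l K ih => simp [plug, before, after, ih, inorder]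

theorem plug_ne_nil (K : Ctx) (ht : t ≠ nil) : K.plug t ≠ nil := by
  cases K <;> simp [plug, ht]

theorem mem_plug (K : Ctx) : x ∈ inorder (K.plug t) ↔ x ∈ K.before ∨ x ∈ inorder t ∨ x ∈ K.after := by
  simp [inorder_plug]

end Ctx

theorem IsSubtree.exists_plug (h : IsSubtree (node a l r) T) :
    ∃ K : Ctx, T = K.plug (node a l r) := by
  induction T with
  | nil => cases h
  | node b L R ihL ihR =>
    rcases h with h | h | h
    · exact ⟨.hole, h.symm⟩
    · obtain ⟨K, hK⟩ := ihL h
      exact ⟨.left b K R, by rw [Ctx.plug, ← hK]⟩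
    · obtain ⟨K, hK⟩ := ihR h
      exact ⟨.right b L K, by rw [Ctx.plug, ← hK]⟩

theorem modifyAt_of_notMem (f : BinaryTree ℕ → BinaryTree ℕ) (h : c ∉ inorder T) :
    modifyAt c f T = T := by
  induction T with
  | nil => rfl
  | node a l r ihl ihr =>
    simp only [mem_inorder_node, not_or] at h
    rw [modifyAt, if_neg (Ne.symm h.1), ihl h.2.1, ihr h.2.2]

theorem modifyAt_plug (f : BinaryTree ℕ → BinaryTree ℕ) (K : Ctx) (h1 : c ∉ K.before)
    (h2 : c ∉ K.after) : modifyAt c f (K.plug (node c l r)) = K.plug (f (node c l r)) := by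
  induction K with
  | hole => simp [Ctx.plug, modifyAt]
  | left a K r ih =>
    simp only [Ctx.before, Ctx.after, List.mem_append, List.mem_cons, not_or] at h1 h2
    rw [Ctx.plug, modifyAt, if_neg (Ne.symm h2.2.1), ih h1 h2.1, modifyAt_of_notMem f h2.2.2]
    rfl
  | right a l K ih =>
    simp only [Ctx.before, Ctx.after, List.mem_append, List.mem_cons, not_or] at h1 h2
    rw [Ctx.plug, modifyAt, if_neg (Ne.symm h1.2.1), ih h1.2.2 h2, modifyAt_of_notMem f h1.1]
    rfl

theorem notMem_ctx_of_nodup {K : Ctx} (h : (inorder (K.plug (node c l r))).Nodup) :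
    c ∉ K.before ∧ c ∉ K.after := by
  rw [Ctx.inorder_plug, List.nodup_append, List.nodup_append] at h
  constructor
  · intro hc
    exact h.1.2.2 c hc c mem_root rfl
  · intro hc
    exact h.2.2 c (List.mem_append_right _ mem_root) c hc rfl

/-- Filling the hole affects only the chain leading into it: `X` is the part of that chain above the
hole, and `Y` collects the chains that do not meet the filled-in tree. An empty tree is excluded
because with `X = 0` it contributes no chain. -/
theorem exists_chains_plug (K : Ctx) : ∃ (X : Multiset ℕ) (Y : Multiset (Multiset ℕ)),
    (∀ t, t ≠ nil → chains (K.plug t) = (X + rightLabels t) ::ₘ (Y + lowerChains t)) ∧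
      ∀ t, IsIncreasing (K.plug t) → ∀ x ∈ X, ∀ y ∈ inorder t, x < y := by
  -- For the induction, the root chain is tracked separately: either it leads into the hole, or it
  -- is a fixed `ρ` and the chain through the hole is a lower one.
  have key : ∃ (X : Multiset ℕ) (Y : Multiset (Multiset ℕ)),
      ((∀ t, t ≠ nil → rightLabels (K.plug t) = X + rightLabels t ∧
        lowerChains (K.plug t) = Y + lowerChains t) ∨
      (∃ ρ, ∀ t, t ≠ nil → rightLabels (K.plug t) = ρ ∧
        lowerChains (K.plug t) = (X + rightLabels t) ::ₘ (Y + lowerChains t))) ∧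
      ∀ t, IsIncreasing (K.plug t) → ∀ x ∈ X, ∀ y ∈ inorder t, x < y := by
    induction K with
    | hole => exact ⟨0, 0, .inl (by simp [Ctx.plug]), by simp⟩
    | left a K r ih =>
      obtain ⟨X, Y, h, hX⟩ := ih
      rcases h with h | ⟨ρ, h⟩
      · refine ⟨X, Y + lowerChains r, .inr ⟨a ::ₘ rightLabels r, fun t ht => ⟨rfl, ?_⟩⟩,
          fun t ht => hX t ht.2.2.1⟩
        rw [Ctx.plug, lowerChains_node, chains_of_ne_nil (K.plug_ne_nil ht), (h t ht).1, (h t ht).2,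
          Multiset.cons_add, add_right_comm]
      · refine ⟨X, ρ ::ₘ (Y + lowerChains r), .inr ⟨a ::ₘ rightLabels r, fun t ht => ⟨rfl, ?_⟩⟩,
          fun t ht => hX t ht.2.2.1⟩
        rw [Ctx.plug, lowerChains_node, chains_of_ne_nil (K.plug_ne_nil ht), (h t ht).1, (h t ht).2,
          Multiset.cons_add, Multiset.cons_add, Multiset.cons_add, add_right_comm,
          Multiset.cons_swap]
    | right a l K ih =>
      obtain ⟨X, Y, h, hX⟩ := ih
      rcases h with h | ⟨ρ, h⟩
      · refine ⟨a ::ₘ X, chains l + Y, .inl fun t ht => ⟨?_, ?_⟩, fun t ht x hx y hy => ?_⟩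
        · rw [Ctx.plug, rightLabels, (h t ht).1, Multiset.cons_add]
        · rw [Ctx.plug, lowerChains_node, (h t ht).2, add_assoc]
        · rcases Multiset.mem_cons.1 hx with rfl | hx
          · exact ht.2.1 y (K.mem_plug.2 (.inr (.inl hy)))
          · exact hX t ht.2.2.2 x hx y hy
      · refine ⟨X, chains l + Y, .inr ⟨a ::ₘ ρ, fun t ht => ⟨?_, ?_⟩⟩,
          fun t ht => hX t ht.2.2.2⟩
        · rw [Ctx.plug, rightLabels, (h t ht).1]
        · rw [Ctx.plug, lowerChains_node, (h t ht).2, Multiset.add_cons, add_assoc]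
  obtain ⟨X, Y, h, hX⟩ := key
  rcases h with h | ⟨ρ, h⟩
  · refine ⟨X, Y, fun t ht => ?_, hX⟩
    rw [chains_of_ne_nil (K.plug_ne_nil ht), (h t ht).1, (h t ht).2]
  · refine ⟨X, ρ ::ₘ Y, fun t ht => ?_, hX⟩
    rw [chains_of_ne_nil (K.plug_ne_nil ht), (h t ht).1, (h t ht).2, Multiset.cons_add,
      Multiset.cons_swap]

theorem IsSubtree.isIncreasing (h : IsSubtree s T) (hT : IsIncreasing T) : IsIncreasing s := by
  induction T with
  | nil => obtain rfl : s = nil := h; exact hT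
  | node a l r ihl ihr =>
    rcases h with rfl | h | h
    · exact hT
    · exact ihl h hT.2.2.1
    · exact ihr h hT.2.2.2

theorem IsSubtree.nodup (h : IsSubtree s T) (hT : (inorder T).Nodup) : (inorder s).Nodup := by
  induction T with
  | nil => obtain rfl : s = nil := h; exact hT
  | node a l r ihl ihr =>
    obtain ⟨-, -, -, h4, h5⟩ := nodup_inorder_node.1 hT
    rcases h with rfl | h | h
    · exact hT
    · exact ihl h h4
    · exact ihr h h5

theorem sum_map_filter_add {α M : Type*} [AddCommMonoid M] (p : α → Prop) [DecidablePred p]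
    (f : α → M) (l : List α) :
    ((l.filter fun x => decide (¬ p x)).map f).sum + ((l.filter fun x => decide (p x)).map f).sum =
      (l.map f).sum := by
  induction l with
  | nil => simp
  | cons x l ih =>
    by_cases hx : p x
    · simp [hx] at ih ⊢
      rw [← ih, add_left_comm]
    · simp [hx] at ih ⊢
      rw [← ih, add_assoc]

/-- A rotation with the label `(a, b)` merges the right chain of `b` into the right chain of `a`. -/
theorem IsRotationBy.chains {S : Finset ℕ} (hT : IsIncreasing T) (hnd : (inorder T).Nodup)
    (h : IsRotationBy T T' b a S) : ∃ (α β : Multiset ℕ) (Z : Multiset (Multiset ℕ)),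
      chains T = β ::ₘ α ::ₘ Z ∧ chains T' = (α + β) ::ₘ Z ∧ a ∈ α ∧ b ∈ β ∧ a < b ∧
      (∀ x ∈ β, b ≤ x) ∧ ∀ x ∈ α, x ≤ a ∨ InRight T a x := by
  obtain ⟨⟨⟨l, r, ht, hb⟩, -⟩, m₀, U₀, U, ms, s, hs, hspine, hS, rfl⟩ := h
  have hs_eq : s = node m₀ (ofLeftSpine ((b, U) :: ms)) U₀ := by
    rw [← ofLeftSpine_leftSpine s, hspine]
    rfl
  have htinc := ht.isIncreasing hT
  have htnd := ht.nodup hnd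
  have hsinc := hs.isIncreasing hT
  set t₁ := ofLeftSpine ((b, U) :: ms.filter fun p => decide (p.1 ∈ S)) with ht₁
  set s₂ := ofLeftSpine ((m₀, U₀) :: ms.filter fun p => decide (p.1 ∉ S)) with hs₂
  have hchains : LabeledTree.chains (ofLeftSpine ((b, U) :: ms)) =
      LabeledTree.chains (ofLeftSpine (ms.filter fun p => decide (p.1 ∉ S))) +
        LabeledTree.chains t₁ := by
    rw [ht₁, chains_ofLeftSpine, chains_ofLeftSpine, chains_ofLeftSpine, List.map_cons,
      List.map_cons, List.sum_cons, List.sum_cons, ← sum_map_filter_add (fun p => p.1 ∈ S) _ ms,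
      add_left_comm]
  obtain ⟨K, hK⟩ := ht.exists_plug
  have hKa := notMem_ctx_of_nodup (hK ▸ hnd)
  -- `m₀` is `a` itself or lies in the left subtree of `a`. In both cases the deletion changes only
  -- the left subtree of `a`, from `l` to `l₂`, and splits off exactly the chains of `T₁`.
  obtain ⟨l₂, hl₂, hT₂⟩ : ∃ l₂, LabeledTree.chains l = LabeledTree.chains l₂ + LabeledTree.chains t₁ ∧
      modifyAt m₀ (fun _ => s₂) T = K.plug (node a l₂ r) := by
    rw [hs_eq] at hs
    rcases IsSubtree.eq_or_left hnd ht hb hs with heq | hsub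
    · cases heq
      refine ⟨_, hchains, ?_⟩
      rw [hK, modifyAt_plug _ _ hKa.1 hKa.2]
      rfl
    · obtain ⟨K₂, hK₂⟩ : ∃ K₂ : Ctx, l = K₂.plug (node m₀ (ofLeftSpine ((b, U) :: ms)) U₀) :=
        hsub.exists_plug
      have hcomp : ∀ u, K.plug (node a (K₂.plug u) r) = (K.comp (.left a K₂ r)).plug u := fun u => by
        rw [Ctx.plug_comp]; rfl
      refine ⟨K₂.plug s₂, ?_, ?_⟩
      · obtain ⟨X, Y, hXY, -⟩ := exists_chains_plug K₂
        rw [hK₂, hXY _ (by simp), hXY s₂ (by simp [hs₂, ofLeftSpine]), lowerChains_node, hchains,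
          show lowerChains s₂ = LabeledTree.chains (ofLeftSpine (ms.filter fun p =>
            decide (p.1 ∉ S))) + lowerChains U₀ from rfl,
          show rightLabels s₂ = m₀ ::ₘ rightLabels U₀ from rfl, rightLabels, Multiset.cons_add]
        congr 1
        ac_rfl
      · have hT2 : T = (K.comp (.left a K₂ r)).plug
            (node m₀ (ofLeftSpine ((b, U) :: ms)) U₀) := by rw [← hcomp, ← hK₂, ← hK]
        have hm₀ := notMem_ctx_of_nodup (hT2 ▸ hnd)
        rw [hT2, modifyAt_plug _ _ hm₀.1 hm₀.2, hcomp]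
  obtain ⟨X, Y, hXY, hX⟩ := exists_chains_plug K
  refine ⟨X + (a ::ₘ rightLabels r), b ::ₘ rightLabels U,
    Y + LabeledTree.chains l₂ + lowerChains t₁ + lowerChains r, ?_, ?_, ?_, ?_, ?_, ?_, ?_⟩
  · rw [hK, hXY _ (by simp), lowerChains_node, hl₂, chains_of_ne_nil (T := t₁)
      (by simp [ht₁, ofLeftSpine]), rightLabels, show rightLabels t₁ = b ::ₘ rightLabels U from rfl,
      Multiset.add_cons, Multiset.add_cons, Multiset.cons_add, Multiset.add_cons,
      Multiset.cons_swap]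
    congr 2
    ac_rfl
  · rw [hT₂, modifyAt_plug _ _ hKa.1 hKa.2, hXY, rightLabels_mergeRight, lowerChains_mergeRight,
      lowerChains_node, rightLabels, show rightLabels t₁ = b ::ₘ rightLabels U from rfl, ← add_assoc]
    · congr 1
      ac_rfl
    · intro h
      have := rightLabels_mergeRight (node a l₂ r) t₁
      rw [h, rightLabels, rightLabels, Multiset.cons_add] at this
      exact Multiset.cons_ne_zero this.symm
  · exact Multiset.mem_add.2 (.inr (Multiset.mem_cons_self _ _))
  · exact Multiset.mem_cons_self _ _
  · exact htinc.1 b hb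
  · intro x hx
    rw [hs_eq] at hsinc
    rcases Multiset.mem_cons.1 hx with rfl | hx
    · exact le_rfl
    · exact (hsinc.2.2.1.2.1 x (mem_of_mem_rightLabels hx)).le
  · intro x hx
    rcases Multiset.mem_add.1 hx with hx | hx
    · exact .inl (hX _ (hK ▸ hT) x hx a mem_root).le
    · rcases Multiset.mem_cons.1 hx with rfl | hx
      · exact .inl le_rfl
      · exact .inr ⟨l, r, ht, mem_of_mem_rightLabels hx⟩

theorem rel_iff_of_chains {α β : Multiset ℕ} {Z : Multiset (Multiset ℕ)}
    (hT : (inorder T).Nodup) (h : chains T = β ::ₘ α ::ₘ Z) (h' : chains T' = (α + β) ::ₘ Z)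
    (ha : a ∈ α) (hb : b ∈ β) :
    Rel T' x y ↔ Rel T x y ∨ (Rel T x a ∧ Rel T y b) ∨ (Rel T x b ∧ Rel T y a) := by
  have hα : α ∈ chains T := by simp [h]
  have hβ : β ∈ chains T := by simp [h]
  have ha' : ∀ z, Rel T z a ↔ z ∈ α := fun z =>
    ⟨fun ⟨γ, hγ, hz, haγ⟩ => chains_unique hT hγ hα haγ ha ▸ hz, fun hz => ⟨α, hα, hz, ha⟩⟩
  have hb' : ∀ z, Rel T z b ↔ z ∈ β := fun z =>
    ⟨fun ⟨γ, hγ, hz, hbγ⟩ => chains_unique hT hγ hβ hbγ hb ▸ hz, fun hz => ⟨β, hβ, hz, hb⟩⟩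
  rw [ha', hb', ha', hb', Rel, Rel, h, h']
  simp only [Multiset.mem_cons, Multiset.mem_add, or_and_right, exists_or, exists_eq_left]
  clear * -
  grind

end LabeledTree

/-! ### Trees with labels in pre-order -/

namespace LabeledTree

open BinaryTree

variable {T T' s t l r l' r' : BinaryTree ℕ} {a b c x y z w : ℕ}

/-- The labels increase in the pre-order: root, left subtree, right subtree. -/
def IsPreorder : BinaryTree ℕ → Prop
  | nil => True
  | node a l r => (∀ x ∈ inorder l, a < x) ∧ (∀ x ∈ inorder r, a < x) ∧
      (∀ x ∈ inorder l, ∀ y ∈ inorder r, x < y) ∧ IsPreorder l ∧ IsPreorder r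

theorem IsPreorder.isIncreasing (h : IsPreorder T) : IsIncreasing T := by
  induction T with
  | nil => trivial
  | node a l r ihl ihr => exact ⟨h.1, h.2.1, ihl h.2.2.2.1, ihr h.2.2.2.2⟩

theorem IsPreorder.nodup (h : IsPreorder T) : (inorder T).Nodup := by
  induction T with
  | nil => exact List.nodup_nil
  | node a l r ihl ihr =>
    obtain ⟨h1, h2, h3, h4, h5⟩ := h
    exact nodup_inorder_node.2 ⟨fun h => (h1 _ h).false, fun h => (h2 _ h).false,
      fun x hx hx' => (h3 _ hx _ hx').false, ihl h4, ihr h5⟩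

theorem IsSubtree.isPreorder (h : IsSubtree s T) (hT : IsPreorder T) : IsPreorder s := by
  induction T with
  | nil => obtain rfl : s = nil := h; exact hT
  | node a l r ihl ihr =>
    rcases h with rfl | h | h
    · exact hT
    · exact ihl h hT.2.2.2.1
    · exact ihr h hT.2.2.2.2

theorem IsPreorder.root_le (h : IsPreorder (node a l r)) (hx : x ∈ inorder (node a l r)) :
    a ≤ x := by
  rcases mem_inorder_node.1 hx with rfl | hx | hx
  · exact le_rfl
  · exact (h.1 x hx).le
  · exact (h.2.1 x hx).le

/-- Left labels precede right labels, so interleaving pairs away from the root lie in the same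
subtree. If `w` is the root, its chain continues from the right child. Either `x` is that child, or
the child replaces `w` and the induction hypothesis for `r` applies. -/
theorem IsPreorder.rel_cross (hT : IsPreorder T) (h1 : w < x) (h2 : x < y) (h3 : y < z)
    (hwy : Rel T w y) (hxz : Rel T x z) : Rel T w x := by
  induction T generalizing w x y z with
  | nil => exact absurd hwy.mem_left (by simp [inorder])
  | node a l r ihl ihr =>
    obtain ⟨hl, hr, hlr, hl', hr'⟩ := id hT
    rcases rel_node.1 hxz with ⟨rfl, -⟩ | ⟨rfl, h⟩ | h | h
    · exact absurd (hT.root_le hwy.mem_left) (by omega)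
    · exact absurd (hT.root_le hwy.mem_left) (by omega)
    · rcases rel_node.1 hwy with ⟨rfl, rfl | h'⟩ | ⟨rfl, h'⟩ | h' | h'
      · omega
      · exact absurd (hlr _ h.mem_right _ (mem_of_mem_rightLabels h')) (by omega)
      · exact absurd (hT.root_le hwy.mem_left) (by omega)
      · exact rel_node.2 (.inr (.inr (.inl (ihl hl' h1 h2 h3 h' h))))
      · exact absurd (hlr _ h.mem_right _ h'.mem_right) (by omega)
    · rcases rel_node.1 hwy with ⟨rfl, rfl | h'⟩ | ⟨rfl, h'⟩ | h' | h'
      · omega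
      · refine rel_node.2 (.inl ⟨rfl, .inr ?_⟩)
        cases r with
        | nil => exact absurd h.mem_left (by simp [inorder])
        | node b l' r' =>
          have hb := hr'.root_le h.mem_left
          rcases hb.eq_or_lt with rfl | hb
          · exact Multiset.mem_cons_self _ _
          · have h4 := (rel_root hr'.nodup).2 (Multiset.mem_cons.1 h')
            exact Multiset.mem_cons.2 ((rel_root hr'.nodup).1 (ihr hr' hb h2 h3 h4 h))
      · exact absurd (hT.root_le hwy.mem_left) (by omega)
      · exact absurd (hlr _ h'.mem_right _ h.mem_left) (by omega)
      · exact rel_node.2 (.inr (.inr (.inr (ihr hr' h1 h2 h3 h' h))))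

theorem mem_inorder_congr (h : ∀ x y, Rel T x y ↔ Rel T' x y) :
    x ∈ inorder T ↔ x ∈ inorder T' := by
  rw [← rel_self_iff, ← rel_self_iff, h]

theorem mem_rightLabels_iff (h : IsPreorder (node a l r)) : x ∈ rightLabels r ↔
    Rel (node a l r) a x ∧ x ≠ a := by
  rw [rel_root h.nodup]
  have : x ∈ rightLabels r → x ≠ a := fun hx => (h.2.1 x (mem_of_mem_rightLabels hx)).ne'
  tauto

/-- A tree with labels in pre-order is determined by its right chains. -/
theorem IsPreorder.ext_rel (hT : IsPreorder T) (hT' : IsPreorder T')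
    (h : ∀ x y, Rel T x y ↔ Rel T' x y) : T = T' := by
  induction T generalizing T' with
  | nil =>
    cases T' with
    | nil => rfl
    | node a l r => exact absurd ((mem_inorder_congr h).2 mem_root) (by simp [inorder])
  | node a l r ihl ihr =>
    cases T' with
    | nil => exact absurd ((mem_inorder_congr h).1 mem_root) (by simp [inorder])
    | node a' l' r' =>
      obtain rfl : a = a' := le_antisymm (hT.root_le ((mem_inorder_congr h).2 mem_root))
        (hT'.root_le ((mem_inorder_congr h).1 mem_root))
      have hR : ∀ x, x ∈ rightLabels r ↔ x ∈ rightLabels r' := fun x => by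
        rw [mem_rightLabels_iff hT, mem_rightLabels_iff hT', h]
      have hmem : ∀ x, x ∈ inorder l ∨ x ∈ inorder r ↔ x ∈ inorder l' ∨ x ∈ inorder r' := by
        intro x
        have h1 := mem_inorder_congr h (x := x)
        rw [mem_inorder_node, mem_inorder_node] at h1
        have h2 : x = a → ¬ (x ∈ inorder l ∨ x ∈ inorder r) := by
          rintro rfl (h | h)
          · exact (hT.1 _ h).false
          · exact (hT.2.1 _ h).false
        have h3 : x = a → ¬ (x ∈ inorder l' ∨ x ∈ inorder r') := by
          rintro rfl (h | h)
          · exact (hT'.1 _ h).false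
          · exact (hT'.2.1 _ h).false
        tauto
      -- The right child is the least element of the root chain after the root. It separates the
      -- labels of the left subtree, which are smaller, from those of the right one.
      have hsplit : ∀ x, (x ∈ inorder l ↔ x ∈ inorder l') ∧ (x ∈ inorder r ↔ x ∈ inorder r') := by
        intro x
        have hm := hmem x
        cases r with
        | nil =>
          cases r' with
          | nil => simpa [inorder] using hm
          | node c' u' v' => exact absurd ((hR c').2 (Multiset.mem_cons_self _ _)) (by simp [rightLabels])
        | node c u v =>
          cases r' with
          | nil => exact absurd ((hR c).1 (Multiset.mem_cons_self _ _)) (by simp [rightLabels])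
          | node c' u' v' =>
            obtain rfl : c = c' := le_antisymm
              (hT.2.2.2.2.root_le (mem_of_mem_rightLabels ((hR c').2 (Multiset.mem_cons_self _ _))))
              (hT'.2.2.2.2.root_le (mem_of_mem_rightLabels ((hR c).1 (Multiset.mem_cons_self _ _))))
            have h1 : x ∈ inorder l → x < c := fun hx => hT.2.2.1 x hx c mem_root
            have h2 : x ∈ inorder l' → x < c := fun hx => hT'.2.2.1 x hx c mem_root
            have h3 : x ∈ inorder (node c u v) → c ≤ x := hT.2.2.2.2.root_le
            have h4 : x ∈ inorder (node c u' v') → c ≤ x := hT'.2.2.2.2.root_le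
            rw [← not_le] at h1 h2
            tauto
      have hrel : ∀ {l r : BinaryTree ℕ}, IsPreorder (node a l r) → ∀ x y,
          (Rel l x y ↔ Rel (node a l r) x y ∧ x ∈ inorder l) ∧
          (Rel r x y ↔ Rel (node a l r) x y ∧ x ∈ inorder r ∧ y ∈ inorder r) := by
        intro l r hT x y
        refine ⟨⟨fun h => ⟨rel_node.2 (.inr (.inr (.inl h))), h.mem_left⟩, ?_⟩,
          ⟨fun h => ⟨rel_node.2 (.inr (.inr (.inr h))), h.mem_left, h.mem_right⟩, ?_⟩⟩
        · rintro ⟨h, hx⟩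
          rcases rel_node.1 h with ⟨rfl, -⟩ | ⟨rfl, h'⟩ | h | h
          · exact ((hT.1 _ hx).false).elim
          · exact ((hT.2.2.1 _ hx _ (mem_of_mem_rightLabels h')).false).elim
          · exact h
          · exact ((hT.2.2.1 _ hx _ h.mem_left).false).elim
        · rintro ⟨h, hx, hy⟩
          rcases rel_node.1 h with ⟨rfl, -⟩ | ⟨rfl, h⟩ | h | h
          · exact ((hT.2.1 _ hx).false).elim
          · exact ((hT.2.1 _ hy).false).elim
          · exact ((hT.2.2.1 _ h.mem_left _ hx).false).elim
          · exact h
      rw [ihl hT.2.2.2.1 hT'.2.2.2.1 fun x y => by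
          rw [(hrel hT x y).1, (hrel hT' x y).1, h, (hsplit x).1],
        ihr hT.2.2.2.2 hT'.2.2.2.2 fun x y => by
          rw [(hrel hT x y).2, (hrel hT' x y).2, h, (hsplit x).2, (hsplit y).2]]

theorem IsPreorder.trichotomy (hT : IsPreorder T) (hx : x ∈ inorder T) (hy : y ∈ inorder T)
    (hxy : x < y) : (∃ l r, IsSubtree (node x l r) T ∧ y ∈ inorder l) ∨
      (∃ l r, IsSubtree (node x l r) T ∧ y ∈ inorder r) ∨
      ∃ c l r, IsSubtree (node c l r) T ∧ x ∈ inorder l ∧ y ∈ inorder r := by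
  induction T with
  | nil => simp [inorder] at hx
  | node a l r ihl ihr =>
    have hax := hT.root_le hx
    obtain ⟨h1, h2, h3, h4, h5⟩ := hT
    rcases mem_inorder_node.1 hx with rfl | hx | hx <;>
      rcases mem_inorder_node.1 hy with rfl | hy | hy
    · omega
    · exact .inl ⟨l, r, isSubtree_refl _, hy⟩
    · exact .inr (.inl ⟨l, r, isSubtree_refl _, hy⟩)
    · omega
    · have hs : ∀ {s}, IsSubtree s l → IsSubtree s (node a l r) := fun h => h.trans isSubtree_left
      rcases ihl h4 hx hy with ⟨u, v, h, h'⟩ | ⟨u, v, h, h'⟩ | ⟨c, u, v, h, h'⟩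
      · exact .inl ⟨u, v, hs h, h'⟩
      · exact .inr (.inl ⟨u, v, hs h, h'⟩)
      · exact .inr (.inr ⟨c, u, v, hs h, h'⟩)
    · exact .inr (.inr ⟨a, l, r, isSubtree_refl _, hx, hy⟩)
    · omega
    · exact absurd (h3 _ hy _ hx) (by omega)
    · have hs : ∀ {s}, IsSubtree s r → IsSubtree s (node a l r) := fun h => h.trans isSubtree_right
      rcases ihr h5 hx hy with ⟨u, v, h, h'⟩ | ⟨u, v, h, h'⟩ | ⟨c, u, v, h, h'⟩
      · exact .inl ⟨u, v, hs h, h'⟩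
      · exact .inr (.inl ⟨u, v, hs h, h'⟩)
      · exact .inr (.inr ⟨c, u, v, hs h, h'⟩)

theorem rel_of_isSubtree (h : IsSubtree s T) (h' : Rel s x y) : Rel T x y := by
  induction T with
  | nil => obtain rfl : s = nil := h; exact h'
  | node a l r ihl ihr =>
    rcases h with rfl | h | h
    · exact h'
    · exact rel_node.2 (.inr (.inr (.inl (ihl h))))
    · exact rel_node.2 (.inr (.inr (.inr (ihr h))))

/-- The right child of a node is the next element of its right chain. -/
theorem IsPreorder.exists_right_child (hT : IsPreorder T) (h : IsSubtree (node c l r) T)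
    (hy : y ∈ inorder r) :
    ∃ c', Rel T c c' ∧ c < c' ∧ c' ≤ y ∧ ∀ x ∈ inorder l, x < c' := by
  have hs := h.isPreorder hT
  cases r with
  | nil => simp [inorder] at hy
  | node c' u v =>
    exact ⟨c', rel_of_isSubtree h (rel_node.2 (.inl ⟨rfl, .inr (Multiset.mem_cons_self _ _)⟩)),
      hs.2.1 c' mem_root, hs.2.2.2.2.root_le hy, fun x hx => hs.2.2.1 x hx c' mem_root⟩

theorem exists_parent (hx : x ∈ inorder T) : (∃ l r, T = node x l r) ∨
    (∃ c l r u, IsSubtree (node c (node x l r) u) T) ∨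
    ∃ c u l r, IsSubtree (node c u (node x l r)) T := by
  induction T with
  | nil => simp [inorder] at hx
  | node a L R ihL ihR =>
    rcases mem_inorder_node.1 hx with rfl | hx | hx
    · exact .inl ⟨L, R, rfl⟩
    · rcases ihL hx with ⟨l, r, rfl⟩ | ⟨c, l, r, u, h⟩ | ⟨c, u, l, r, h⟩
      · exact .inr (.inl ⟨a, l, r, R, isSubtree_refl _⟩)
      · exact .inr (.inl ⟨c, l, r, u, h.trans isSubtree_left⟩)
      · exact .inr (.inr ⟨c, u, l, r, h.trans isSubtree_left⟩)
    · rcases ihR hx with ⟨l, r, rfl⟩ | ⟨c, l, r, u, h⟩ | ⟨c, u, l, r, h⟩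
      · exact .inr (.inr ⟨a, L, l, r, isSubtree_refl _⟩)
      · exact .inr (.inl ⟨c, l, r, u, h.trans isSubtree_right⟩)
      · exact .inr (.inr ⟨c, u, l, r, h.trans isSubtree_right⟩)

/-- Append a tree at the end of the right-extended sequence of the root. -/
def appendRight : BinaryTree ℕ → BinaryTree ℕ → BinaryTree ℕ
  | nil, t => t
  | node a l r, t => node a l (appendRight r t)

theorem inorder_appendRight (s t : BinaryTree ℕ) :
    inorder (appendRight s t) = inorder s ++ inorder t := by
  induction s with
  | nil => rfl
  | node a l r _ ih => simp [appendRight, inorder, ih]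

theorem rightSpine_appendRight (s t : BinaryTree ℕ) :
    rightSpine (appendRight s t) = rightSpine s ++ rightSpine t := by
  induction s with
  | nil => rfl
  | node a l r _ ih => simp [appendRight, rightSpine, ih]

theorem IsPreorder.appendRight (hs : IsPreorder s) (ht : IsPreorder t)
    (h : ∀ x ∈ inorder s, ∀ y ∈ inorder t, x < y) : IsPreorder (appendRight s t) := by
  induction s with
  | nil => exact ht
  | node a l r _ ih =>
    obtain ⟨h1, h2, h3, h4, h5⟩ := hs
    refine ⟨h1, fun x hx => ?_, fun x hx y hy => ?_, h4, ih h5 fun x hx => h x (mem_right hx)⟩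
    · rw [inorder_appendRight, List.mem_append] at hx
      rcases hx with hx | hx
      · exact h2 x hx
      · exact h a mem_root x hx
    · rw [inorder_appendRight, List.mem_append] at hy
      rcases hy with hy | hy
      · exact h3 x hx y hy
      · exact h x (mem_left hx) y hy

theorem merge_eq_append_of_not {α : Type*} (le : α → α → Bool) (xs ys : List α)
    (h : ∀ x ∈ xs, ∀ y ∈ ys, le x y = false) : xs.merge ys le = ys ++ xs := by
  induction ys with
  | nil => simp
  | cons y ys ih =>
    cases xs with
    | nil => simp
    | cons x xs =>
      rw [List.cons_merge_cons, h x (by simp) y (by simp)]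
      simp only [Bool.false_eq_true, if_false, List.cons_append, List.cons.injEq, true_and]
      exact ih fun x hx y hy => h x hx y (List.mem_cons_of_mem _ hy)

theorem mem_of_mem_rightSpine {p : ℕ × BinaryTree ℕ} (h : p ∈ rightSpine t) : p.1 ∈ inorder t := by
  refine mem_of_mem_rightLabels ?_
  rw [rightLabels_eq, Multiset.mem_coe]
  exact List.mem_map_of_mem h

/-- The labels of `s` fall between `a` and those of `r`, so the merge inserts the right path of `s`
directly after `a`. -/
theorem mergeRight_eq (h1 : ∀ x ∈ inorder s, a < x)
    (h2 : ∀ x ∈ inorder s, ∀ y ∈ inorder r, x < y) :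
    mergeRight (node a l r) s = node a l (appendRight s r) := by
  rw [mergeRight, ← ofRightSpine_rightSpine (node a l (appendRight s r))]
  congr 1
  have h3 := merge_eq_append_of_not (fun p q : ℕ × BinaryTree ℕ => decide (p.1 ≤ q.1))
    (rightSpine r) (rightSpine s) fun x hx y hy => by
      have := h2 _ (mem_of_mem_rightSpine hy) _ (mem_of_mem_rightSpine hx)
      simpa using this
  rw [rightSpine, rightSpine, rightSpine_appendRight, ← h3]
  rcases hs : rightSpine s with - | ⟨p, ps⟩
  · simp
  · have : a < p.1 := h1 _ (mem_of_mem_rightSpine (by rw [hs]; simp))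
    rw [List.cons_merge_cons]
    simp [this.le]

theorem IsPreorder.plug (K : Ctx) (h : IsPreorder (K.plug s)) (ht : IsPreorder t)
    (hts : ∀ x ∈ inorder t, x ∈ inorder s) : IsPreorder (K.plug t) := by
  have hmem : ∀ (K : Ctx) x, x ∈ inorder (K.plug t) → x ∈ inorder (K.plug s) := fun K x => by
    rw [Ctx.mem_plug, Ctx.mem_plug]
    have := hts x
    tauto
  induction K with
  | hole => exact ht
  | left a K r ih =>
    obtain ⟨h1, h2, h3, h4, h5⟩ := h
    exact ⟨fun x hx => h1 x (hmem K x hx), h2, fun x hx => h3 x (hmem K x hx), ih h4, h5⟩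
  | right a l K ih =>
    obtain ⟨h1, h2, h3, h4, h5⟩ := h
    exact ⟨h1, fun x hx => h2 x (hmem K x hx), fun x hx y hy => h3 x hx y (hmem K y hy), h4, ih h5⟩

theorem inLeft_inRight_iff_of_isSubtree (hT : (inorder T).Nodup) (h : IsSubtree (node c l r) T) :
    (InLeft T c x ↔ x ∈ inorder l) ∧ (InRight T c x ↔ x ∈ inorder r) := by
  refine ⟨⟨?_, fun hx => ⟨l, r, h, hx⟩⟩, ⟨?_, fun hx => ⟨l, r, h, hx⟩⟩⟩
  · rintro ⟨l', r', h', hx⟩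
    rwa [(h.unique hT h').1]
  · rintro ⟨l', r', h', hx⟩
    rwa [(h.unique hT h').2]

/-- The second admissibility condition is vacuous in pre-order: no label in a right subtree is
smaller than one in the left subtree of the same node. -/
theorem IsPreorder.isAdmissible (hT : IsPreorder T) (h : InLeft T a b) : IsAdmissible T b a := by
  refine ⟨h, ?_⟩
  rintro c m ⟨l, r, hs, hb⟩ hm hmb
  have := (hs.isPreorder hT).2.2.1 _ hb _ ((inLeft_inRight_iff_of_isSubtree hT.nodup hs).2.1 hm)
  omega

end LabeledTree

/-! ### Rotations of pre-order trees are steps -/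

namespace LabeledTree

open BinaryTree

variable {n : ℕ} {T T' s t l r l' r' : BinaryTree ℕ} {a b c x y z w : ℕ} {P Q : NCP n}

/-- A rotation of a tree in pre-order is a step between the partitions into right chains. -/
theorem IsRotationBy.step {S : Finset ℕ} (hT : IsPreorder T) (h : IsRotationBy T T' b a S)
    (hP : ∀ x y, P.Rel x y ↔ Rel T x y) (hQ : ∀ x y, Q.Rel x y ↔ Rel T' x y) : P.Step Q a b := by
  obtain ⟨l, r, ht, hb⟩ := h.1.1
  obtain ⟨α, β, Z, h1, h2, ha, hb', hab, hβ, hα⟩ := h.chains hT.isIncreasing hT.nodup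
  have hrel : ∀ x y, Q.Rel x y ↔ P.Rel x y ∨ (P.Rel x a ∧ P.Rel y b) ∨ (P.Rel x b ∧ P.Rel y a) := by
    intro x y
    simp only [hP, hQ]
    exact rel_iff_of_chains hT.nodup h1 h2 ha hb'
  have hαT : α ∈ LabeledTree.chains T := by simp [h1]
  have hβT : β ∈ LabeledTree.chains T := by simp [h1]
  refine ⟨hab, ?_, fun x hx => ?_, ((hP a a).2 ⟨α, hαT, ha, ha⟩).mem_left,
    ((hP b b).2 ⟨β, hβT, hb', hb'⟩).mem_left, hrel⟩
  · rintro ⟨y, hy, hyb⟩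
    obtain ⟨γ, hγ, hyγ, hbγ⟩ := (hP _ _).1 hyb
    rw [chains_unique hT.nodup hγ hβT hbγ hb'] at hyγ
    exact absurd (hβ y hyγ) (by omega)
  · obtain ⟨γ, hγ, haγ, hxγ⟩ := (hP _ _).1 hx
    rw [chains_unique hT.nodup hγ hαT haγ ha] at hxγ
    refine (hα x hxγ).imp id fun hx => ?_
    exact (ht.isPreorder hT).2.2.1 b hb x ((inLeft_inRight_iff_of_isSubtree hT.nodup ht).2.1 hx)

/-- If `b` were in the right subtree of `a`, the right child of `a` would violate `gap`. If `a` and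
`b` were separated at a node `c` with right child `c'`, then either `c' = b` is not minimal, or the
pair `c, c'` crosses `a, b` in `Q`, which forces `c'` into the block of `a`. -/
theorem _root_.NCP.Step.inLeft (hT : IsPreorder T) (hP : ∀ x y, P.Rel x y ↔ Rel T x y)
    (h : P.Step Q a b) : ∃ l r, IsSubtree (node a l r) T ∧ b ∈ inorder l := by
  have ha : a ∈ inorder T := rel_self_iff.1 ((hP _ _).1 (P.rel_refl h.mem_left))
  have hb : b ∈ inorder T := rel_self_iff.1 ((hP _ _).1 (P.rel_refl h.mem_right))
  rcases hT.trichotomy ha hb h.lt with h' | ⟨l, r, hs, hb⟩ | ⟨c, l, r, hs, ha, hb⟩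
  · exact h'
  · obtain ⟨c', h1, h2, h3, -⟩ := hT.exists_right_child hs hb
    rw [← hP] at h1
    rcases h3.eq_or_lt with rfl | h3
    · exact absurd (h.gap _ h1) (by omega)
    · exact absurd (h.gap _ h1) (by omega)
  · obtain ⟨c', h1, h2, h3, h4⟩ := hT.exists_right_child hs hb
    have hca := (hs.isPreorder hT).1 a ha
    have hac := h4 a ha
    rw [← hP] at h1
    rcases h3.eq_or_lt with rfl | h3
    · exact (h.min ⟨c, h2, h1⟩).elim
    · have h5 := NCP.le_iff_rel.1 h.le _ _ h1
      have h6 := Q.rel_cross hca hac h3 h5 h.rel_labels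
      have h7 := h.le_label ((h5.symm.trans h6).trans h.rel_labels) h3
      exact absurd (h.gap _ h7.symm) (by omega)

/-- Every step from the partition of a tree in pre-order lifts to a rotation. -/
theorem _root_.NCP.Step.exists_rotation (hT : IsPreorder T) (hP : ∀ x y, P.Rel x y ↔ Rel T x y)
    (h : P.Step Q a b) : ∃ T' S, IsPreorder T' ∧ (inorder T').Perm (inorder T) ∧
      IsRotationBy T T' b a S ∧ ∀ x y, Q.Rel x y ↔ Rel T' x y := by
  obtain ⟨l, r, ht, hb⟩ := h.inLeft hT hP
  have htp := ht.isPreorder hT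
  -- `b` is a left child: it is not the root since `a < b`, and a right child is not minimal in its
  -- chain.
  obtain ⟨m₀, l', U, U₀, hs⟩ : ∃ m₀ l' U U₀, IsSubtree (node m₀ (node b l' U) U₀) T := by
    rcases exists_parent (ht.mem (mem_left hb)) with ⟨u, v, rfl⟩ | h' | ⟨c, u, v, v', hs⟩
    · exact absurd (hT.root_le (ht.mem mem_root)) (by have := h.lt; omega)
    · exact h'
    · refine (h.min ⟨c, (hs.isPreorder hT).2.1 b mem_root, (hP _ _).2 ?_⟩).elim
      exact rel_of_isSubtree hs (rel_node.2 (.inl ⟨rfl, .inr (Multiset.mem_cons_self _ _)⟩))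
  obtain ⟨K, hK⟩ := ht.exists_plug
  have hKa := notMem_ctx_of_nodup (hK ▸ hT.nodup)
  set sb := node b l' U with hsb
  have hsp := hs.isPreorder hT
  obtain ⟨l₂, hl₂, hperm, hpre, hlt⟩ : ∃ l₂,
      modifyAt m₀ (fun _ => node m₀ nil U₀) T = K.plug (node a l₂ r) ∧
      (inorder l₂ ++ inorder sb).Perm (inorder l) ∧ IsPreorder l₂ ∧ ∀ y ∈ inorder l₂, y < b := by
    rcases IsSubtree.eq_or_left hT.nodup ht hb hs with heq | hsub
    · cases heq
      refine ⟨nil, ?_, by simp [inorder, hsb], trivial, by simp [inorder]⟩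
      rw [hK, modifyAt_plug _ _ hKa.1 hKa.2]
    · obtain ⟨K₂, hK₂⟩ : ∃ K₂ : Ctx, l = K₂.plug (node m₀ sb U₀) := hsub.exists_plug
      have hlp := htp.2.2.2.1
      have hcomp : ∀ u, K.plug (node a (K₂.plug u) r) = (K.comp (.left a K₂ r)).plug u := fun u => by
        rw [Ctx.plug_comp]; rfl
      have hperm : (inorder (K₂.plug (node m₀ nil U₀)) ++ inorder sb).Perm (inorder l) := by
        rw [hK₂, Ctx.inorder_plug, Ctx.inorder_plug,
          show inorder (node m₀ nil U₀) = m₀ :: inorder U₀ from rfl,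
          show inorder (node m₀ sb U₀) = inorder sb ++ m₀ :: inorder U₀ from rfl,
          ← Multiset.coe_eq_coe]
        simp only [← Multiset.coe_add]
        ac_rfl
      refine ⟨K₂.plug (node m₀ nil U₀), ?_, hperm, ?_, fun y hy => ?_⟩
      · have hT2 : T = (K.comp (.left a K₂ r)).plug (node m₀ sb U₀) := by
          rw [← hcomp, ← hK₂, ← hK]
        have hm₀ := notMem_ctx_of_nodup (hT2 ▸ hT.nodup)
        rw [hT2, modifyAt_plug _ _ hm₀.1 hm₀.2, hcomp]
      · rw [hK₂] at hlp
        refine hlp.plug K₂ ⟨by simp [inorder], hsp.2.1, by simp [inorder], trivial, hsp.2.2.2.2⟩ ?_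
        intro x hx
        rw [mem_inorder_node] at hx ⊢
        simp only [inorder, List.not_mem_nil, false_or] at hx
        tauto
      · have hnd := hperm.nodup_iff.2 hlp.nodup
        rw [List.nodup_append] at hnd
        have hysb : y ∉ inorder sb := fun hy' => hnd.2.2 y hy y hy' rfl
        have hyl : y ∈ inorder l := hperm.subset (List.mem_append_left _ hy)
        have hsbl : IsSubtree sb l := isSubtree_left.trans hsub
        -- A label `y > b` outside the subtree of `b` is separated from `b` at some `c` in `l`. With
        -- `c'` the right child of `c`, one has `a < c < b < c'`, and the pair `c, c'` crosses `a,
        -- b` in `Q`. This puts `c` into the block of `a`, against `gap`.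
        by_contra! hcon
        rcases hcon.eq_or_lt with rfl | hby
        · exact hysb mem_root
        rcases hlp.trichotomy hb hyl hby with ⟨u, v, h', hy'⟩ | ⟨u, v, h', hy'⟩ | ⟨c, u, v, h', hb', hy'⟩
        · refine hysb (mem_left ?_)
          rwa [(h'.unique hlp.nodup hsbl).1] at hy'
        · refine hysb (mem_right ?_)
          rwa [(h'.unique hlp.nodup hsbl).2] at hy'
        · have h'' : IsSubtree (node c u v) T := (h'.trans isSubtree_left).trans ht
          obtain ⟨c', h1, h2, h3, h4⟩ := hT.exists_right_child h'' hy'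
          have hcb := (h''.isPreorder hT).1 b hb'
          have hac := htp.1 c (h'.mem mem_root)
          rw [← hP] at h1
          have h5 := NCP.le_iff_rel.1 h.le _ _ h1
          have h6 := Q.rel_cross hac hcb (h4 b hb') h.rel_labels h5
          have h7 := h.le_label (h6.symm.trans h.rel_labels) hcb
          exact absurd (h.gap _ h7.symm) (by omega)
  obtain ⟨hl1, hl2, hl3, hl4, hl5⟩ := htp
  have hmemsb : ∀ x ∈ inorder sb, x ∈ inorder l := fun x hx =>
    hperm.subset (List.mem_append_right _ hx)
  have hmeml₂ : ∀ x ∈ inorder l₂, x ∈ inorder l := fun x hx =>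
    hperm.subset (List.mem_append_left _ hx)
  have hsbp : IsPreorder sb := hsp.2.2.2.1
  have hmerge : mergeRight (node a l₂ r) sb = node a l₂ (appendRight sb r) :=
    mergeRight_eq (fun x hx => hl1 x (hmemsb x hx)) (fun x hx => hl3 x (hmemsb x hx))
  have hspine : ofLeftSpine ((b, U) :: leftSpine l') = sb := by
    rw [ofLeftSpine, ofLeftSpine_leftSpine]
  -- The whole left path below `b` moves, so `T₁` is the full subtree at `b`. What remains of `l` is
  -- smaller than `b`, which keeps the result in pre-order.
  let S : Finset ℕ := ((leftSpine l').map Prod.fst).toFinset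
  have hmemS : ∀ p ∈ leftSpine l', p.1 ∈ S := fun p hp =>
    List.mem_toFinset.2 (List.mem_map_of_mem hp)
  have hf1 : (leftSpine l').filter (fun p => decide (p.1 ∈ S)) = leftSpine l' :=
    List.filter_eq_self.2 fun p hp => by simpa using hmemS p hp
  have hf2 : (leftSpine l').filter (fun p => decide (p.1 ∉ S)) = [] :=
    List.filter_eq_nil_iff.2 fun p hp => by simpa using hmemS p hp
  have hrot : IsRotationBy T (K.plug (node a l₂ (appendRight sb r))) b a S := by
    refine ⟨hT.isAdmissible ⟨l, r, ht, hb⟩, m₀, U₀, U, leftSpine l', _, hs, rfl,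
      fun x hx => List.mem_toFinset.1 hx, ?_⟩
    rw [hf1, hf2, hspine, ← hmerge]
    change _ = modifyAt a _ (modifyAt m₀ (fun _ => node m₀ nil U₀) T)
    rw [hl₂, modifyAt_plug _ _ hKa.1 hKa.2]
  refine ⟨_, S, ?_, ?_, hrot, ?_⟩
  · refine IsPreorder.plug K (hK ▸ hT) ⟨fun x hx => hl1 x (hmeml₂ x hx), fun x hx => ?_,
      fun x hx y hy => ?_, hpre, hsbp.appendRight hl5 fun x hx => hl3 x (hmemsb x hx)⟩ fun x hx => ?_
    · rw [inorder_appendRight, List.mem_append] at hx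
      exact hx.elim (fun hx => hl1 x (hmemsb x hx)) (hl2 x)
    · rw [inorder_appendRight, List.mem_append] at hy
      exact hy.elim (fun hy => (hlt x hx).trans_le (hsbp.root_le hy))
        (hl3 x (hmeml₂ x hx) y)
    · rw [mem_inorder_node, inorder_appendRight, List.mem_append] at hx
      rcases hx with rfl | hx | hx | hx
      · exact mem_root
      · exact mem_left (hmeml₂ x hx)
      · exact mem_left (hmemsb x hx)
      · exact mem_right hx
  · rw [hK, Ctx.inorder_plug, Ctx.inorder_plug]
    refine (List.Perm.append_left _ ?_).append_right _
    rw [inorder, inorder, inorder_appendRight]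
    refine List.perm_middle.trans (List.Perm.trans ?_ List.perm_middle.symm)
    rw [← List.append_assoc]
    exact (hperm.append_right _).cons a
  · intro x y
    obtain ⟨α, β, Z, h1, h2, ha, hb', -⟩ := hrot.chains hT.isIncreasing hT.nodup
    rw [rel_iff_of_chains hT.nodup h1 h2 ha hb', h.rel]
    simp only [hP]

end LabeledTree

/-! ### The pattern `312` in blocks and in words -/

theorem pair_sublist_flatten {bs : List (List ℕ)} {y z : ℕ} (h : [y, z].Sublist bs.flatten) :
    ∃ j k : Fin bs.length, j ≤ k ∧ y ∈ bs.get j ∧ z ∈ bs.get k := by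
  induction bs with
  | nil => simp at h
  | cons B bs ih =>
    rw [List.flatten_cons, List.sublist_append_iff] at h
    obtain ⟨u, v, huv, hu, hv⟩ := h
    rcases u with - | ⟨u₀, - | ⟨u₁, u⟩⟩
    · obtain rfl : [y, z] = v := by simpa using huv
      obtain ⟨j, k, hjk, hj, hk⟩ := ih hv
      exact ⟨j.succ, k.succ, Fin.succ_le_succ_iff.2 hjk, hj, hk⟩
    · obtain ⟨rfl, rfl⟩ : y = u₀ ∧ [z] = v := by simpa using huv
      obtain ⟨D, hD, hz⟩ := List.mem_flatten.1 (hv.subset (List.mem_singleton_self z))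
      obtain ⟨k, rfl⟩ := List.get_of_mem hD
      exact ⟨⟨0, by simp⟩, k.succ, Fin.mk_le_of_le_val (Nat.zero_le _),
        hu.subset (List.mem_singleton_self y), hz⟩
    · obtain ⟨rfl, rfl, -⟩ : y = u₀ ∧ z = u₁ ∧ u = [] ∧ v = [] := by
        simpa using huv
      exact ⟨⟨0, by simp⟩, ⟨0, by simp⟩, le_rfl, hu.subset (by simp), hu.subset (by simp)⟩

/-- Blocks are increasing, so a descent from `x` to `y` in the word has to cross a block boundary.
-/
theorem triple_sublist_flatten {bs : List (List ℕ)} (hs : ∀ B ∈ bs, B.Pairwise (· < ·))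
    {x y z : ℕ} (hyx : y < x) (h : [x, y, z].Sublist bs.flatten) :
    ∃ i j k : Fin bs.length, i < j ∧ j ≤ k ∧ x ∈ bs.get i ∧ y ∈ bs.get j ∧ z ∈ bs.get k := by
  induction bs with
  | nil => simp at h
  | cons B bs ih =>
    rw [List.flatten_cons, List.sublist_append_iff] at h
    obtain ⟨u, v, huv, hu, hv⟩ := h
    rcases u with - | ⟨u₀, - | ⟨u₁, u⟩⟩
    · obtain rfl : [x, y, z] = v := by simpa using huv
      obtain ⟨i, j, k, hij, hjk, h⟩ := ih (fun B hB => hs B (List.mem_cons_of_mem _ hB)) hv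
      exact ⟨i.succ, j.succ, k.succ, Fin.succ_lt_succ_iff.2 hij, Fin.succ_le_succ_iff.2 hjk, h⟩
    · obtain ⟨rfl, rfl⟩ : x = u₀ ∧ [y, z] = v := by simpa using huv
      obtain ⟨j, k, hjk, hj, hk⟩ := pair_sublist_flatten hv
      exact ⟨⟨0, by simp⟩, j.succ, k.succ, Fin.succ_pos j, Fin.succ_le_succ_iff.2 hjk,
        hu.subset (List.mem_singleton_self x), hj, hk⟩
    · obtain ⟨rfl, rfl, -⟩ : x = u₀ ∧ y = u₁ ∧ [z] = u ++ v := by simpa using huv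
      have := (hs B (by simp)).sublist hu
      simp only [List.pairwise_cons, List.mem_cons] at this
      have := this.1 y (.inl rfl)
      omega

theorem singleton_sublist_flatten {bs : List (List ℕ)} {z : ℕ} {k : Fin bs.length}
    (h : z ∈ bs.get k) : [z].Sublist bs.flatten :=
  List.singleton_sublist.2 (List.mem_flatten.2 ⟨_, List.get_mem _ _, h⟩)

theorem pair_sublist_of_lt {B : List ℕ} (hB : B.Pairwise (· < ·)) {y z : ℕ} (hy : y ∈ B)
    (hz : z ∈ B) (hyz : y < z) : [y, z].Sublist B := by
  induction B with
  | nil => simp at hy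
  | cons b B ih =>
    rw [List.pairwise_cons] at hB
    rcases List.mem_cons.1 hy with rfl | hy' <;> rcases List.mem_cons.1 hz with rfl | hz'
    · omega
    · exact (List.singleton_sublist.2 hz').cons_cons _
    · exact absurd (hB.1 y hy') (by omega)
    · exact (ih hB.2 hy' hz').cons _

theorem pair_sublist_flatten_of_le {bs : List (List ℕ)} (hs : ∀ B ∈ bs, B.Pairwise (· < ·))
    {y z : ℕ} (hyz : y < z) {j k : Fin bs.length} (hjk : j ≤ k) (hy : y ∈ bs.get j)
    (hz : z ∈ bs.get k) : [y, z].Sublist bs.flatten := by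
  induction bs with
  | nil => exact j.elim0
  | cons B bs ih =>
    rw [List.flatten_cons]
    cases j using Fin.cases with
    | zero =>
      cases k using Fin.cases with
      | zero =>
        exact (pair_sublist_of_lt (hs B (by simp)) hy hz hyz).trans (List.sublist_append_left _ _)
      | succ k =>
        exact (List.singleton_sublist.2 hy).append (singleton_sublist_flatten (k := k) hz)
    | succ j =>
      cases k using Fin.cases with
      | zero => exact absurd hjk (by simp)
      | succ k =>
        exact (ih (fun B hB => hs B (List.mem_cons_of_mem _ hB)) (Fin.succ_le_succ_iff.1 hjk)
          hy hz).trans (List.sublist_append_right _ _)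

theorem triple_sublist_flatten_of_lt {bs : List (List ℕ)} (hs : ∀ B ∈ bs, B.Pairwise (· < ·))
    {x y z : ℕ} (hyz : y < z) {i j k : Fin bs.length} (hij : i < j) (hjk : j ≤ k)
    (hx : x ∈ bs.get i) (hy : y ∈ bs.get j) (hz : z ∈ bs.get k) :
    [x, y, z].Sublist bs.flatten := by
  induction bs with
  | nil => exact j.elim0
  | cons B bs ih =>
    rw [List.flatten_cons]
    have hs' : ∀ B ∈ bs, B.Pairwise (· < ·) := fun B hB => hs B (List.mem_cons_of_mem _ hB)
    cases j using Fin.cases with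
    | zero => exact absurd hij (by simp)
    | succ j =>
      cases k using Fin.cases with
      | zero => exact absurd hjk (by simp)
      | succ k =>
        cases i using Fin.cases with
        | zero =>
          exact (List.singleton_sublist.2 hx).append
            (pair_sublist_flatten_of_le hs' hyz (Fin.succ_le_succ_iff.1 hjk) hy hz)
        | succ i =>
          exact (ih hs' (Fin.succ_lt_succ_iff.1 hij) (Fin.succ_le_succ_iff.1 hjk)
            hx hy hz).trans (List.sublist_append_right _ _)

theorem NCCP.avoids312_iff {n : ℕ} (π : NCCP n) : π.Avoids312 ↔
    ∀ x y z, [x, y, z].Sublist π.word → ¬ (y < z ∧ z < x) := by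
  constructor
  · rintro h x y z hsub ⟨h1, h2⟩
    obtain ⟨i, j, k, hij, hjk, hx, hy, hz⟩ :=
      triple_sublist_flatten π.increasing (h1.trans h2) hsub
    exact h i j k hij hjk x hx y hy z hz ⟨h1, h2⟩
  · rintro h i j k hij hjk x hx y hy z hz ⟨h1, h2⟩
    exact h x y z (triple_sublist_flatten_of_lt π.increasing h1 hij hjk hx hy hz) ⟨h1, h2⟩

/-! ### Pre-order trees and `312`-avoiding words -/

namespace LabeledTree

open BinaryTree

variable {n : ℕ} {T T' s t l r l' r' : BinaryTree ℕ} {a b c x y z w : ℕ}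

theorem IsPreorder.not_sublist (hT : IsPreorder T) (h : [x, y, z].Sublist (inorder T)) :
    ¬ (y < z ∧ z < x) := by
  rintro ⟨hyz, hzx⟩
  induction T with
  | nil => simp [inorder] at h
  | node a l r ihl ihr =>
    obtain ⟨h1, h2, h3, h4, h5⟩ := hT
    rw [inorder, List.sublist_append_iff] at h
    obtain ⟨u, v, huv, hu, hv⟩ := h
    rcases u with - | ⟨u₀, - | ⟨u₁, - | ⟨u₂, u⟩⟩⟩
    · obtain rfl : [x, y, z] = v := by simpa using huv
      rw [List.sublist_cons_iff] at hv
      rcases hv with hv | ⟨q, hq, hv⟩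
      · exact ihr h5 hv
      · obtain ⟨rfl, rfl⟩ : x = a ∧ [y, z] = q := by simpa using hq
        have := h2 y (hv.subset (by simp))
        omega
    · obtain ⟨rfl, rfl⟩ : x = u₀ ∧ [y, z] = v := by simpa using huv
      have hz : z ∈ inorder r := by
        rw [List.sublist_cons_iff] at hv
        rcases hv with hv | ⟨q, hq, hv⟩
        · exact hv.subset (by simp)
        · obtain ⟨-, rfl⟩ : y = a ∧ [z] = q := by simpa using hq
          exact hv.subset (by simp)
      have := h3 x (hu.subset (by simp)) z hz
      omega
    · obtain ⟨rfl, rfl, rfl⟩ : x = u₀ ∧ y = u₁ ∧ [z] = v := by simpa using huv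
      have hz : z ∈ a :: inorder r := hv.subset (by simp)
      rcases List.mem_cons.1 hz with rfl | hz
      · have := h1 y (hu.subset (by simp))
        omega
      · have := h3 x (hu.subset (by simp)) z hz
        omega
    · obtain ⟨rfl, rfl, rfl, rfl, rfl⟩ : x = u₀ ∧ y = u₁ ∧ z = u₂ ∧ u = [] ∧ v = [] := by
        simpa using huv
      exact ihl h4 hu

/-- For `x` left and `y` right of the root `a`, the word contains `x, a, y` with `a` smallest;
avoidance forces `x < y`. -/
theorem IsIncreasing.isPreorder (hT : IsIncreasing T) (hnd : (inorder T).Nodup)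
    (h : ∀ x y z, [x, y, z].Sublist (inorder T) → ¬ (y < z ∧ z < x)) : IsPreorder T := by
  induction T with
  | nil => trivial
  | node a l r ihl ihr =>
    obtain ⟨h1, h2, h3, h4⟩ := hT
    obtain ⟨-, -, h5, h6, h7⟩ := nodup_inorder_node.1 hnd
    refine ⟨h1, h2, fun x hx y hy => ?_, ihl h3 h6 fun x y z hs => h x y z ?_,
      ihr h4 h7 fun x y z hs => h x y z ?_⟩
    · have h8 := h x a y ((List.singleton_sublist.2 hx).append
        ((List.singleton_sublist.2 hy).cons_cons a))
      have h9 := h2 y hy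
      have h10 : x ≠ y := fun h' => h5 x hx (h' ▸ hy)
      omega
    · exact hs.trans (List.sublist_append_left _ _)
    · exact hs.trans ((List.sublist_cons_self _ _).trans (List.sublist_append_right _ _))

/-- The root has to be the least letter; it cuts the word into the words of the two subtrees. -/
theorem exists_isIncreasing (w : List ℕ) (hw : w.Nodup) : ∃ T, IsIncreasing T ∧ inorder T = w := by
  induction hk : w.length using Nat.strong_induction_on generalizing w with
  | _ k ih =>
  by_cases hne : w = []
  · exact ⟨nil, trivial, hne.symm⟩
  obtain ⟨a, ha, hmin⟩ := w.toFinset.exists_min_image id (by simpa using hne)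
  simp only [List.mem_toFinset, id] at ha hmin
  obtain ⟨u, v, rfl⟩ := List.append_of_mem ha
  rw [List.nodup_append, List.nodup_cons] at hw
  simp only [List.length_append, List.length_cons] at hk
  obtain ⟨l, hl, rfl⟩ := ih u.length (by omega) u hw.1 rfl
  obtain ⟨r, hr, rfl⟩ := ih v.length (by omega) v hw.2.1.2 rfl
  refine ⟨node a l r, ⟨fun x hx => ?_, fun x hx => ?_, hl, hr⟩, rfl⟩
  · exact lt_of_le_of_ne (hmin x (by simp [hx])) (hw.2.2 x hx a (by simp)).symm
  · refine lt_of_le_of_ne (hmin x (by simp [hx])) ?_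
    rintro rfl
    exact hw.2.1.1 hx

theorem IsIncreasing.root_le (hT : IsIncreasing (node a l r)) (hx : x ∈ inorder (node a l r)) :
    a ≤ x := by
  rcases mem_inorder_node.1 hx with rfl | hx | hx
  · exact le_rfl
  · exact (hT.1 x hx).le
  · exact (hT.2.1 x hx).le

theorem IsIncreasing.ext_inorder (hT : IsIncreasing T) (hT' : IsIncreasing T')
    (h : inorder T = inorder T') : T = T' := by
  induction T generalizing T' with
  | nil =>
    cases T' with
    | nil => rfl
    | node a l r => simp [inorder] at h
  | node a l r ihl ihr =>
    cases T' with
    | nil => simp [inorder] at h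
    | node a' l' r' =>
      obtain rfl : a = a' := le_antisymm (hT.root_le (h ▸ mem_root))
        (hT'.root_le (h ▸ mem_root))
      rw [inorder, inorder, List.append_cons_inj_of_notMem (fun h => (hT.1 a h).false)
        (fun h => (hT.2.1 a h).false)] at h
      rw [ihl hT.2.2.1 hT'.2.2.1 h.1, ihr hT.2.2.2 hT'.2.2.2 h.2.2]

theorem IsLabeled.nodup (h : IsLabeled n T) : (inorder T).Nodup :=
  h.1.nodup_iff.2 List.nodup_range'

theorem IsLabeled.mem_iff (h : IsLabeled n T) : x ∈ inorder T ↔ x ∈ Finset.Icc 1 n := by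
  rw [h.1.mem_iff, List.mem_range'_1, Finset.mem_Icc]
  omega

/-- The right chains of a tree in pre-order form a non-crossing partition. -/
theorem IsPreorder.exists_ncp (hT : IsPreorder T) (h : IsLabeled n T) :
    ∃ P : NCP n, ∀ x y, P.Rel x y ↔ Rel T x y :=
  NCP.exists_rel n (Rel T) (fun _ hx => rel_self_iff.2 (h.mem_iff.2 hx))
    (fun _ _ h' => h.mem_iff.1 h'.mem_left) (fun _ _ => Rel.symm)
    (fun _ _ _ => Rel.trans h.nodup) (fun _ _ _ _ => hT.rel_cross)

/-- A path of left edges has only singleton chains, so for `m = 1` it provides the bottom element.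
-/
theorem exists_leftPath (k m : ℕ) : ∃ T, IsPreorder T ∧ inorder T = (List.range' m k).reverse ∧
    ∀ x y, Rel T x y → x = y := by
  induction k generalizing m with
  | zero => exact ⟨nil, trivial, rfl, fun x y h => absurd h.mem_left (by simp [inorder])⟩
  | succ k ih =>
    obtain ⟨T, h1, h2, h3⟩ := ih (m + 1)
    refine ⟨node m T nil, ⟨fun x hx => ?_, by simp [inorder], by simp [inorder], h1, trivial⟩, ?_,
      fun x y h => ?_⟩
    · rw [h2, List.mem_reverse, List.mem_range'_1] at hx
      omega
    · rw [inorder, h2, List.range'_succ, List.reverse_cons]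
      rfl
    · rcases rel_node.1 h with ⟨rfl, rfl | h⟩ | ⟨-, h⟩ | h | h
      · rfl
      · simp [rightLabels] at h
      · simp [rightLabels] at h
      · exact h3 x y h
      · exact absurd h.mem_left (by simp [inorder])

end LabeledTree

/-! ### Blocks as the ascending runs of a word -/

theorem isChain_and_of_pairwise {α : Type*} {R S : α → α → Prop} {l : List α} (h : l.IsChain R)
    (h' : l.Pairwise S) : l.IsChain fun a b => R a b ∧ S a b := by
  induction l with
  | nil => exact .nil
  | cons a l ih =>
    rw [List.isChain_cons] at h ⊢
    rw [List.pairwise_cons] at h'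
    exact ⟨fun b hb => ⟨h.1 b hb, h'.1 b (List.mem_of_mem_head? hb)⟩, ih h.2 h'.2⟩

namespace NCCP

open LabeledTree

variable {n : ℕ} {π π' : NCCP n} {a b x y : ℕ}

/-- For increasing blocks the condition on maxima and minima says that there is a descent at each
boundary. So the blocks are the maximal ascending runs, and the word determines them. -/
theorem blocks_eq_splitBy (π : NCCP n) :
    π.blocks = π.word.splitBy fun x y => decide (x < y) := by
  symm
  rw [List.splitBy_eq_iff]
  refine ⟨rfl, fun h => π.ne_nil _ h rfl, fun B hB => ?_, ?_⟩
  · simpa using (π.increasing B hB).isChain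
  · refine π.descent.imp_of_mem_imp fun B C hB hC h => ?_
    obtain ⟨x, hx, y, hy, hxy⟩ := h
    refine ⟨π.ne_nil B hB, π.ne_nil C hC, ?_⟩
    have h1 : x ≤ B.getLast (π.ne_nil B hB) := by
      exact ((π.increasing B hB).imp le_of_lt).rel_getLast hx
    have h2 : C.head (π.ne_nil C hC) ≤ y := by
      exact ((π.increasing C hC).imp le_of_lt).rel_head hy
    simp only [decide_eq_false_iff_not]
    omega

theorem ext_word (h : π.word = π'.word) : π = π' :=
  NCCP.ext (by rw [blocks_eq_splitBy, blocks_eq_splitBy, h])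

theorem exists_word (w : List ℕ) (hw : w.Perm (List.range' 1 n)) : ∃ π : NCCP n, π.word = w := by
  refine ⟨⟨w.splitBy fun x y => decide (x < y), fun B hB => List.ne_nil_of_mem_splitBy hB, ?_,
    fun B hB => ?_, ?_⟩, List.flatten_splitBy _ _⟩
  · rwa [List.flatten_splitBy]
  · have := List.isChain_of_mem_splitBy hB
    simp only [decide_eq_true_eq] at this
    exact this.pairwise
  · have hnd : w.Nodup := hw.nodup_iff.2 List.nodup_range'
    have hfl : (w.splitBy fun x y => decide (x < y)).flatten.Nodup := by
      rwa [List.flatten_splitBy]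
    have hdis := (List.nodup_flatten.1 hfl).2
    refine (isChain_and_of_pairwise (List.isChain_getLast_head_splitBy _ w) hdis).imp ?_
    rintro B C ⟨⟨hB, hC, h⟩, h'⟩
    refine ⟨_, List.getLast_mem hB, _, List.head_mem hC, ?_⟩
    have hne : B.getLast hB ≠ C.head hC := fun heq =>
      h' (List.getLast_mem hB) (heq ▸ List.head_mem hC)
    simp only [decide_eq_false_iff_not] at h
    omega

theorem exists_tree (π : NCCP n) : ∃ T, IsLabeled n T ∧ inorder T = π.word := by
  obtain ⟨T, hT, h⟩ := exists_isIncreasing π.word (π.perm.nodup_iff.2 List.nodup_range')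
  exact ⟨T, ⟨h ▸ π.perm, hT⟩, h⟩

end NCCP

/-! ### The isomorphism of the two realizations -/

namespace NCCP312

open LabeledTree

variable {n : ℕ} {a b : ℕ}

theorem exists_ncp (π : NCCP312 n) : ∃ (T : BinaryTree ℕ) (P : NCP n), IsLabeled n T ∧
    IsPreorder T ∧ inorder T = π.1.word ∧ ∀ x y, P.Rel x y ↔ Rel T x y := by
  obtain ⟨T, hT, h⟩ := π.1.exists_tree
  have hpre : IsPreorder T := hT.2.isPreorder hT.nodup (h ▸ π.1.avoids312_iff.1 π.2)
  obtain ⟨P, hP⟩ := hpre.exists_ncp hT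
  exact ⟨T, P, hT, hpre, h, hP⟩

/-- The labeled tree with the given in-order word. -/
noncomputable def tree (π : NCCP312 n) : BinaryTree ℕ := π.exists_ncp.choose

/-- The non-crossing partition into right chains. -/
noncomputable def toNCP (π : NCCP312 n) : NCP n := π.exists_ncp.choose_spec.choose

theorem isLabeled_tree (π : NCCP312 n) : IsLabeled n π.tree :=
  π.exists_ncp.choose_spec.choose_spec.1

theorem isPreorder_tree (π : NCCP312 n) : IsPreorder π.tree :=
  π.exists_ncp.choose_spec.choose_spec.2.1

theorem inorder_tree (π : NCCP312 n) : inorder π.tree = π.1.word :=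
  π.exists_ncp.choose_spec.choose_spec.2.2.1

theorem rel_toNCP (π : NCCP312 n) : ∀ x y, π.toNCP.Rel x y ↔ Rel π.tree x y :=
  π.exists_ncp.choose_spec.choose_spec.2.2.2

theorem tree_eq (π : NCCP312 n) {T : BinaryTree ℕ} (hT : IsLabeled n T)
    (h : inorder T = π.1.word) : T = π.tree :=
  hT.2.ext_inorder π.isLabeled_tree.2 (h.trans π.inorder_tree.symm)

theorem toNCP_injective : Function.Injective (toNCP (n := n)) := by
  intro π π' h
  have h1 : π.tree = π'.tree := π.isPreorder_tree.ext_rel π'.isPreorder_tree fun x y => by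
    rw [← rel_toNCP, ← rel_toNCP, h]
  refine Subtype.ext (NCCP.ext_word ?_)
  rw [← inorder_tree, ← inorder_tree, h1]

theorem exists_of_tree {T : BinaryTree ℕ} (hT : IsLabeled n T) (hpre : IsPreorder T) :
    ∃ π : NCCP312 n, π.tree = T := by
  obtain ⟨π, hπ⟩ := NCCP.exists_word _ hT.1
  refine ⟨⟨π, π.avoids312_iff.2 fun x y z h => ?_⟩, ?_⟩
  · rw [hπ] at h
    exact hpre.not_sublist h
  · exact (tree_eq _ hT hπ.symm).symm

theorem exists_rotatesTo (π : NCCP312 n) {Q : NCP n} (h : π.toNCP.Step Q a b) :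
    ∃ π' : NCCP312 n, NCCP.RotatesTo π.1 π'.1 a b ∧ π'.toNCP = Q := by
  obtain ⟨T', S, hpre, hperm, hrot, hrel⟩ := h.exists_rotation π.isPreorder_tree π.rel_toNCP
  have hT' : IsLabeled n T' := ⟨hperm.trans π.isLabeled_tree.1, hpre.isIncreasing⟩
  obtain ⟨π', rfl⟩ := exists_of_tree hT' hpre
  exact ⟨π', ⟨π.tree, π'.tree, π.isLabeled_tree, hT', π.inorder_tree, π'.inorder_tree, S, hrot⟩,
    NCP.ext_rel fun x y => by rw [rel_toNCP, hrel]⟩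

theorem rotatesTo_iff (π π' : NCCP312 n) :
    NCCP.RotatesTo π.1 π'.1 a b ↔ π.toNCP.Step π'.toNCP a b := by
  constructor
  · rintro ⟨T, T', hT, hT', h, h', S, hrot⟩
    obtain rfl := π.tree_eq hT h
    obtain rfl := π'.tree_eq hT' h'
    exact hrot.step π.isPreorder_tree π.rel_toNCP π'.rel_toNCP
  · intro h
    obtain ⟨ρ, hρ, h'⟩ := π.exists_rotatesTo h
    rwa [← toNCP_injective h']

/-- The order on `NCCP312 n` is induced, so a sequence of rotations may pass through words
containing `312`. Therefore this is proved for all increasing trees, where a rotation still merges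
two chains. -/
theorem rel_of_rotates {π π' : NCCP n} (h : Relation.ReflTransGen NCCP.Rotates π π') :
    ∀ T T' : BinaryTree ℕ, IsLabeled n T → IsLabeled n T' → inorder T = π.word →
      inorder T' = π'.word → ∀ x y, Rel T x y → Rel T' x y := by
  induction h with
  | refl =>
    intro T T' hT hT' h h' x y hxy
    rwa [← hT.2.ext_inorder hT'.2 (h.trans h'.symm)]
  | tail _ hrot ih =>
    intro T T' hT hT' h h' x y hxy
    obtain ⟨a, b, U, U', hU, hU', hw, hw', S, hrot⟩ := hrot
    obtain rfl := hU'.2.ext_inorder hT'.2 (hw'.trans h'.symm)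
    obtain ⟨α, β, Z, h1, h2, ha, hb, -⟩ := hrot.chains hU.2 hU.nodup
    exact (rel_iff_of_chains hU.nodup h1 h2 ha hb).2 (.inl (ih T U hT hU h hw x y hxy))

theorem toNCP_mono {π π' : NCCP312 n} (h : π ≤ π') : π.toNCP ≤ π'.toNCP := by
  rw [NCP.le_iff_rel]
  intro x y hxy
  rw [rel_toNCP] at hxy ⊢
  exact rel_of_rotates h _ _ π.isLabeled_tree π'.isLabeled_tree π.inorder_tree π'.inorder_tree x y
    hxy

/-- Steps toward `Q` lift to rotations one at a time; `n` minus the rank decreases. Starting from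
the bottom this gives surjectivity of `toNCP`, and together with injectivity it shows that `toNCP`
reflects the order. -/
theorem exists_le_toNCP_eq (π : NCCP312 n) {Q : NCP n} (h : π.toNCP ≤ Q) :
    ∃ π', π ≤ π' ∧ π'.toNCP = Q := by
  induction hk : n - π.toNCP.rank using Nat.strong_induction_on generalizing π with
  | _ k ih =>
  rcases h.eq_or_lt with h | h
  · exact ⟨π, le_rfl, h⟩
  · obtain ⟨R, a, b, hR, hRQ⟩ := NCP.exists_step_of_lt h
    obtain ⟨ρ, hρ, rfl⟩ := π.exists_rotatesTo hR
    have h1 := hR.rank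
    have h2 := NCP.rank_strictMono h
    have h3 := Q.rank_le
    obtain ⟨π', h', h''⟩ := ih _ (by omega) ρ hRQ rfl
    refine ⟨π', le_trans (b := ρ) ?_ h', h''⟩
    exact Relation.ReflTransGen.single ⟨a, b, hρ⟩

theorem toNCP_surjective : Function.Surjective (toNCP (n := n)) := by
  intro Q
  obtain ⟨T, h1, h2, h3⟩ := exists_leftPath n 1
  obtain ⟨π, rfl⟩ := exists_of_tree ⟨h2 ▸ List.reverse_perm _, h1.isIncreasing⟩ h1
  obtain ⟨π', -, h⟩ := π.exists_le_toNCP_eq (Q := Q) (NCP.le_iff_rel.2 fun x y h => by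
    have h' := h.mem_left
    rw [rel_toNCP] at h
    rw [h3 x y h] at h' ⊢
    exact Q.rel_refl h')
  exact ⟨π', h⟩

/-- The two realizations of the Kreweras lattice are isomorphic. -/
noncomputable def orderIso (n : ℕ) : NCCP312 n ≃o NCP n where
  toEquiv := Equiv.ofBijective toNCP ⟨toNCP_injective, toNCP_surjective⟩
  map_rel_iff' {π π'} := by
    refine ⟨fun h => ?_, toNCP_mono⟩
    obtain ⟨ρ, hρ, h'⟩ := π.exists_le_toNCP_eq h
    rwa [← toNCP_injective h']

theorem hasRefinedLabels_iff (C : Flag (NCCP312 n)) (a b : Fin (n - 1) → ℕ) :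
    HasRefinedLabels C a b ↔ NCP.HasStepLabels (Flag.map (orderIso n) C) a b := by
  have hcarrier : (Flag.map (orderIso n) C).carrier = toNCP '' C.carrier := rfl
  constructor
  · rintro ⟨x, hx, hrot⟩
    refine ⟨fun i => (x i).toNCP, ?_, fun i => (rotatesTo_iff _ _).1 (hrot i)⟩
    rw [hcarrier, hx, Set.image_image]
  · rintro ⟨x, hx, hstep⟩
    choose y hy using fun i => toNCP_surjective (x i)
    refine ⟨y, ?_, fun i => (rotatesTo_iff _ _).2 ?_⟩
    · refine toNCP_injective.image_injective ?_
      rw [← hcarrier, hx, Set.image_image]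
      simp only [hy]
    · rw [hy, hy]
      exact hstep i

end NCCP312

/-- For `n ≥ 1` the Kreweras lattice of `[n]`, in both of its realizations, has `n ^ (n - 2)`
maximal chains (for `n = 1` this is `1`). Moreover every maximal chain of the `312`-avoiding
noncommutative crossing partitions has exactly one sequence of refined labels `(aᵢ, bᵢ)`, and
`C ↦ a` is a bijection onto the parking functions of length `n - 1`. -/
theorem mainTheorem9 (n : ℕ) (hn : 1 ≤ n) :
    Nat.card (Flag (NCP n)) = n ^ (n - 2) ∧
    Nat.card (Flag (NCCP312 n)) = n ^ (n - 2) ∧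
    ∃ (Φ : Flag (NCCP312 n) ≃ {a : Fin (n - 1) → ℕ // IsParkingFunction a})
      (β : Flag (NCCP312 n) → Fin (n - 1) → ℕ),
      ∀ (C : Flag (NCCP312 n)) (a b : Fin (n - 1) → ℕ),
        HasRefinedLabels C a b ↔ a = (Φ C).1 ∧ b = β C := by
  obtain ⟨Φ, β, h⟩ := NCP.exists_flag_equiv hn
  have hcard : Nat.card {a : Fin (n - 1) → ℕ // IsParkingFunction a} = n ^ (n - 2) := by
    -- With `m = n - 1` the base `m + 1` is `n` because `n ≥ 1`, and the truncated exponents agree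
    -- also for `n = 1`.
    rw [card_isParkingFunction, Nat.sub_add_cancel hn, Nat.sub_sub]
  refine ⟨(Nat.card_congr Φ).trans hcard,
    (Nat.card_congr ((Flag.map (NCCP312.orderIso n)).trans Φ)).trans hcard,
    (Flag.map (NCCP312.orderIso n)).trans Φ, fun C => β (Flag.map (NCCP312.orderIso n) C),
    fun C a b => ?_⟩
  rw [NCCP312.hasRefinedLabels_iff]
  exact h _ a b
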